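/- Let the unit circle $\{|z|=1\}$ carry a finite alternating arrangement $P$ of boundary segments: $n$ closed arcs of positive length (isothermal segments), consecutive ones being separated by open arcs of positive length (adiabatic segments). Each isothermal segment is designated hot or cold, and both kinds occur. The interior problem is posed in $D_i=\{|z|<1\}$ and the exterior problem in $D_e=\{|z|>1\}$. For temperatures $T_c<T_h$, a solution of the problem in $D\in\{D_i,D_e\}$ is a function $T$ that is continuous on $\overline D$, harmonic and bounded in $D$, equal to $T_h$ on the hot segments and to $T_c$ on the cold ones, and has zero normal derivative at every point of the adiabatic segments. For conductivity $k>0$, the heat flow of $T$ is $Q=\int_{\mathrm{hot}} k\,\partial_n T\,d\theta$, where $\partial_n$ is the derivative along the normal pointing out of $D$; that is, $\partial_nT$ is to exist in the interior of each hot arc and to be integrable there. A number $S$ is the shape factor of the problem if for all $k>0$ and $T_c<T_h$ a solution exists and every solution has heat flow $Q=S\,k\,(T_h-T_c)$. Let $\overline P$ be the mirror image of $P$ in the real axis. Then: 1. The map $z\mapsto 1/z$ of the Riemann sphere is a conformal equivalence of the interior problem for $P$ with the exterior problem for $\overline P$: it maps $D_i$ biholomorphically onto $D_e\cup\{\infty\}$,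 is continuous up to the boundary, maps the circle bijectively onto itself, and maps the hot, cold and adiabatic parts of the circle for $P$ onto those for $\overline P$. The reflection $z\mapsto\bar z$ maps the exterior problem for $\overline P$ in the same manner (bijectively, continuously up to the boundary, matching the boundary conditions) onto the exterior problem for $P$. 2. The interior problem for $P$, the exterior problem for $P$ and the exterior problem for $\overline P$ each have exactly one shape factor, and the three are equal. In particular $S_i=S_e$. -/

import Mathlib

open Set

namespace ShapeFactor

/-! ### Boundary arrangements on the unit circle -/

/-- A finite alternating arrangement of isothermal and adiabatic segments on the unit circle.
There are `n` isothermal segments, the `i`-th one being the closed arc of angles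
`[lo i, hi i]`, listed counterclockwise within one turn. Consecutive isothermal segments are
separated by a gap of positive length, and the `n` gaps are the adiabatic segments.
Each isothermal segment is held at one of two temperatures (hot or cold), and both occur. -/
structure Arrangement where
  n : ℕ
  lo : Fin n → ℝ
  hi : Fin n → ℝ
  isHot : Fin n → Prop
  lo_lt_hi : ∀ i, lo i < hi i
  hi_lt_lo : ∀ i j, i < j → hi i < lo j
  hi_lt_turn : ∀ i j, hi i < lo j + 2 * Real.pi
  exists_hot : ∃ i, isHot i
  exists_cold : ∃ i, ¬ isHot i

/-- The point of the unit circle at angle `θ`. -/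
noncomputable def circlePt (θ : ℝ) : ℂ := Complex.exp (θ * Complex.I)

namespace Arrangement

/-- The part of the unit circle held at the high temperature. -/
def hot (P : Arrangement) : Set ℂ := ⋃ (i) (_ : P.isHot i), circlePt '' Icc (P.lo i) (P.hi i)

/-- The part of the unit circle held at the low temperature. -/
def cold (P : Arrangement) : Set ℂ :=
  ⋃ (i) (_ : ¬ P.isHot i), circlePt '' Icc (P.lo i) (P.hi i)

/-- The adiabatic part of the unit circle. -/
def adiabatic (P : Arrangement) : Set ℂ := Metric.sphere (0 : ℂ) 1 \ (P.hot ∪ P.cold)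

/-- The mirror image of an arrangement in the real axis (angles change sign). -/
def reflect (P : Arrangement) : Arrangement where
  n := P.n
  lo i := -P.hi i.rev
  hi i := -P.lo i.rev
  isHot i := P.isHot i.rev
  lo_lt_hi i := neg_lt_neg (P.lo_lt_hi _)
  hi_lt_lo i j h := neg_lt_neg (P.hi_lt_lo _ _ (Fin.rev_lt_rev.mpr h))
  hi_lt_turn i j := by have := P.hi_lt_turn j.rev i.rev; linarith
  exists_hot := by obtain ⟨i, hi⟩ := P.exists_hot; exact ⟨i.rev, by simpa using hi⟩
  exists_cold := by obtain ⟨i, hi⟩ := P.exists_cold; exact ⟨i.rev, by simpa using hi⟩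

end Arrangement

/-! ### The interior and the exterior heat conduction problem -/

/-- The two sides of the unit circle. -/
inductive Side where
  | interior
  | exterior

/-- The planar domain in which heat is conducted. -/
def region : Side → Set ℂ
  | .interior => Metric.ball 0 1
  | .exterior => {z | 1 < ‖z‖}

/-- The unit normal at the point `ζ` of the unit circle that points out of the domain. -/
def outwardNormal : Side → ℂ → ℂ
  | .interior, ζ => ζ
  | .exterior, ζ => -ζ

/-- `T` has the (one-sided) outward normal derivative `d` at the point `ζ` of the unit circle. -/
def HasNormalDeriv (s : Side) (T : ℂ → ℝ) (ζ : ℂ) (d : ℝ) : Prop :=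
  HasDerivWithinAt (fun t : ℝ => T (ζ + t * outwardNormal s ζ)) d (Iic 0) 0

/-- `T` is a steady temperature field on the given side of the unit circle, with temperatures
`Tc` and `Th` on the cold and hot segments and zero normal derivative on the adiabatic ones:
harmonic in the domain, bounded (a condition only at infinity), and continuous up to the circle. -/
structure IsTemperature (s : Side) (P : Arrangement) (Tc Th : ℝ) (T : ℂ → ℝ) : Prop where
  harmonic : InnerProductSpace.HarmonicOnNhd T (region s)
  continuousOn : ContinuousOn T (closure (region s))
  bounded : ∃ C : ℝ, ∀ z ∈ region s, |T z| ≤ C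
  eq_hot : ∀ ζ ∈ P.hot, T ζ = Th
  eq_cold : ∀ ζ ∈ P.cold, T ζ = Tc
  neumann : ∀ ζ ∈ P.adiabatic, HasNormalDeriv s T ζ 0

/-- `Q` is the rate at which heat flows from the hot segments into the domain, for the temperature
field `T` and the conductivity `k`. By Fourier's law the flux through the boundary into the domain
is `k` times the outward normal derivative `g` of `T`; it is integrated with respect to arc length
over the hot segments, and is required to be integrable there. -/
def HasHeatFlow (s : Side) (P : Arrangement) (k : ℝ) (T : ℂ → ℝ) (Q : ℝ) : Prop :=
  ∃ g : ℝ → ℝ,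
    (∀ i, P.isHot i → ∀ θ ∈ Ioo (P.lo i) (P.hi i), HasNormalDeriv s T (circlePt θ) (g θ)) ∧
    (∀ i, P.isHot i →
      IntervalIntegrable g MeasureTheory.volume (P.lo i) (P.hi i)) ∧
    Q = open Classical in ∑ i with P.isHot i, ∫ θ in P.lo i..P.hi i, k * g θ

/-- `S` is the shape factor of the problem: for all conductivities and all pairs of temperatures
the problem is solvable, and the heat flow is `Q = S * k * (Th - Tc)`. -/
def IsShapeFactor (s : Side) (P : Arrangement) (S : ℝ) : Prop :=
  ∀ k Tc Th : ℝ, 0 < k → Tc < Th →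
    (∃ T, IsTemperature s P Tc Th T) ∧
    ∀ T, IsTemperature s P Tc Th T → HasHeatFlow s P k T (S * k * (Th - Tc))

/-! ### Conformal maps on the Riemann sphere -/

/-- The map `z ↦ 1 / z` of the Riemann sphere, which exchanges `0` and `∞`. -/
noncomputable def sphereInv (p : OnePoint ℂ) : OnePoint ℂ :=
  open Classical in
  p.elim ((0 : ℂ) : OnePoint ℂ) (fun z => if z = 0 then OnePoint.infty else ((z⁻¹ : ℂ) : OnePoint ℂ))

/-- The reflection of the Riemann sphere in the real axis, which fixes `∞`. -/
noncomputable def sphereConj (p : OnePoint ℂ) : OnePoint ℂ :=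
  p.elim OnePoint.infty (fun z => ((starRingEnd ℂ z : ℂ) : OnePoint ℂ))

/-- The standard holomorphic parametrization of the Riemann sphere near `p`, sending `0` to `p`:
`w ↦ a + w` for `p = a` finite, and `w ↦ 1 / w` for `p = ∞`. -/
noncomputable def sphereParam (p : OnePoint ℂ) : ℂ → OnePoint ℂ :=
  p.elim (fun w => sphereInv w) (fun a w => ((a + w : ℂ) : OnePoint ℂ))

/-- The holomorphic coordinate on the Riemann sphere near `q`, inverse to `sphereParam q`:
`z ↦ z - a` for `q = a` finite, and `z ↦ 1 / z` for `q = ∞`. -/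
noncomputable def sphereCoord (q : OnePoint ℂ) : OnePoint ℂ → ℂ :=
  q.elim (fun x => x.elim 0 (fun z => z⁻¹)) (fun a x => x.elim 0 (fun z => z - a))

/-- Holomorphy of a self-map of the Riemann sphere at a point, in the standard coordinates. -/
def SphereHolomorphicAt (f : OnePoint ℂ → OnePoint ℂ) (p : OnePoint ℂ) : Prop :=
  ContinuousAt f p ∧ AnalyticAt ℂ (fun w => sphereCoord (f p) (f (sphereParam p w))) 0

/-- The two sides of the unit circle as domains of the Riemann sphere; the exterior contains `∞`. -/
def sphereRegion : Side → Set (OnePoint ℂ)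
  | .interior => (fun z : ℂ => (z : OnePoint ℂ)) '' region .interior
  | .exterior => insert OnePoint.infty ((fun z : ℂ => (z : OnePoint ℂ)) '' region .exterior)

/-- A set of complex numbers, regarded as a set of points of the Riemann sphere. -/
def onSphere (A : Set ℂ) : Set (OnePoint ℂ) := (fun z : ℂ => (z : OnePoint ℂ)) '' A

/-- `f` maps one problem to the other: it is a bijection between the domains and between their
boundaries, continuous up to the boundary, and matches the boundary conditions. -/
structure Carries (f : OnePoint ℂ → OnePoint ℂ) (s : Side) (P : Arrangement)
    (s' : Side) (P' : Arrangement) : Prop where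
  bijOn_region : BijOn f (sphereRegion s) (sphereRegion s')
  bijOn_boundary : BijOn f (onSphere (Metric.sphere 0 1)) (onSphere (Metric.sphere 0 1))
  continuousOn : ContinuousOn f (closure (sphereRegion s))
  image_hot : f '' onSphere P.hot = onSphere P'.hot
  image_cold : f '' onSphere P.cold = onSphere P'.cold
  image_adiabatic : f '' onSphere P.adiabatic = onSphere P'.adiabatic

/-- The two problems are conformally equivalent via `f`. -/
structure ConformallyEquivalentVia (f : OnePoint ℂ → OnePoint ℂ) (s : Side) (P : Arrangement)
    (s' : Side) (P' : Arrangement) : Prop extends Carries f s P s' P' where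
  holomorphic : ∀ p ∈ sphereRegion s, SphereHolomorphicAt f p

end ShapeFactor

/-! ### Maximum principles and a boundary point lemma on the punctured disc. -/

open Filter Topology

namespace ShapeFactor

open InnerProductSpace

/-! Write an interior solution as `T = Re F`. At a point `ζ` of the circle its normal and tangential
derivatives are `Re (ζ F' ζ)` and `-Im (ζ F' ζ)`, so what is needed is that `ζ F' ζ` be real on the
isothermal arcs and imaginary on the adiabatic ones. As in the Schwarz–Christoffel formula, this is
achieved by a constant times `p(z) ∏ (1 - z / a)^(-1/2)`, the product running over the `2n` arc
endpoints `a`, with `p` in a real space of dimension `n - 1` of polynomials of degree at most `n -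
2`. `exists_basisDensity_sq` checks this on squares, so no branch has to be followed along the
circle. The inverse square roots are integrable, so the primitives are continuous up to the circle
and the flux is integrable. Together with an additive constant there are `n` real parameters for `n`
arc temperatures; the linear map `arcTemperatures` is injective by uniqueness, hence surjective.

Uniqueness (`nonpos_of_mixed_boundary`) is Hopf's argument: a positive boundary maximum of a
nonconstant solution would have positive outward normal derivative, so it cannot lie on an adiabatic
arc. It is proved for bounded functions on the punctured disc in order to cover both sides:
`circleInv` carries the exterior there, with `∞` becoming the puncture.

The composite `z ↦ 1 / conj z` of the two sphere maps fixes every point of the circle and preserves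
outward normal derivatives. Interior and exterior solutions therefore have the same flux density,
and uniqueness and linearity turn the flux of the normalized solution (temperatures 0 and 1) into
the shape factor. Passing to the mirror image only substitutes `-θ` for `θ` in the flux integrals.
-/

/-- A real harmonic function with a local maximum is locally constant. -/
theorem eventually_eq_of_isLocalMax_of_harmonicAt {u : ℂ → ℝ} {z : ℂ}
    (hu : HarmonicAt u z) (hz : IsLocalMax u z) : ∀ᶠ w in 𝓝 z, u w = u z := by
  obtain ⟨r, hr, hball⟩ := Metric.eventually_nhds_iff_ball.1 hu.eventually
  obtain ⟨f, hf, hfu⟩ :=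
    HarmonicOnNhd.exists_analyticOnNhd_ball_re_eq (z := z) (R := r) (f := u) hball
  have hmem : ∀ᶠ w in 𝓝 z, w ∈ Metric.ball z r := Metric.ball_mem_nhds z hr
  -- With `u = Re f`, the modulus of `exp f` is `exp u`, so the maximum modulus principle applies.
  have hnorm : ∀ w ∈ Metric.ball z r, ‖Complex.exp (f w)‖ = Real.exp (u w) := by
    intro w hw
    rw [Complex.norm_exp]
    exact congrArg _ (hfu hw)
  have hd : ∀ᶠ w in 𝓝 z, DifferentiableAt ℂ (fun w => Complex.exp (f w)) w := by
    filter_upwards [hmem] with w hw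
    exact (hf w hw).differentiableAt.cexp
  have hmax : IsLocalMax (norm ∘ fun w => Complex.exp (f w)) z := by
    filter_upwards [hmem, hz] with w hw hwz
    simp only [Function.comp_apply]
    rw [hnorm w hw, hnorm z (Metric.mem_ball_self hr)]
    exact Real.exp_le_exp.2 hwz
  filter_upwards [Complex.norm_eventually_eq_of_isLocalMax hd hmax, hmem] with w hw hwr
  rw [hnorm w hwr, hnorm z (Metric.mem_ball_self hr)] at hw
  exact Real.exp_injective hw

/-- Weak maximum principle on a compact set whose points off `U` play the role of the boundary. -/
theorem le_of_harmonicOnNhd_of_le_diff {u : ℂ → ℝ} {K U : Set ℂ} {M : ℝ} (hK : IsCompact K)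
    (hU : IsOpen U) (hUK : U ⊆ K) (hc : ContinuousOn u K) (hh : HarmonicOnNhd u U)
    (hM : ∀ z ∈ K \ U, u z ≤ M) {z : ℂ} (hz : z ∈ K) : u z ≤ M := by
  obtain ⟨z₀, hz₀, hmax⟩ := hK.exists_isMaxOn ⟨z, hz⟩ hc
  refine (hmax hz).trans ?_
  by_contra! hlt
  -- If the maximum exceeded `M`, the set where it is attained would be nonempty, open and compact,
  -- hence all of the noncompact plane.
  set E := {w ∈ K | u w = u z₀} with hE
  have hEU : E ⊆ U := by
    intro w hw
    by_contra hwU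
    have := hM w ⟨hw.1, hwU⟩
    rw [hw.2] at this
    exact absurd this (not_le.2 hlt)
  have hEo : IsOpen E := by
    rw [isOpen_iff_mem_nhds]
    intro w hw
    have hwU : U ∈ 𝓝 w := hU.mem_nhds (hEU hw)
    have hloc : IsLocalMax u w := by
      filter_upwards [hwU] with v hv
      rw [hw.2]
      exact hmax (hUK hv)
    filter_upwards [eventually_eq_of_isLocalMax_of_harmonicAt (hh w (hEU hw)) hloc, hwU]
      with v hv hvU
    exact ⟨hUK hvU, hv.trans hw.2⟩
  have hEc : IsClosed E := by
    have := hc.preimage_isClosed_of_isClosed hK.isClosed (isClosed_singleton (x := u z₀))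
    exact this
  have huniv : E = univ := IsClopen.eq_univ ⟨hEc, hEo⟩ ⟨z₀, hz₀, rfl⟩
  have hEK : IsCompact E := hK.of_isClosed_subset hEc fun w hw => hw.1
  rw [huniv] at hEK
  exact noncompact_univ ℂ hEK

/-- Strong maximum principle on a preconnected open set. -/
theorem eqOn_of_isPreconnected_of_harmonicOnNhd {u : ℂ → ℝ} {U : Set ℂ} {M : ℝ}
    (hU : IsOpen U) (hconn : IsPreconnected U) (hh : HarmonicOnNhd u U)
    (hM : ∀ z ∈ U, u z ≤ M) {z : ℂ} (hz : z ∈ U) (hzM : u z = M) {w : ℂ} (hw : w ∈ U) :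
    u w = M := by
  set E := {w ∈ U | u w = M} with hE
  have hEo : IsOpen E := by
    rw [isOpen_iff_mem_nhds]
    intro w hw
    have hwU : U ∈ 𝓝 w := hU.mem_nhds hw.1
    have hloc : IsLocalMax u w := by
      filter_upwards [hwU] with v hv
      rw [hw.2]
      exact hM v hv
    filter_upwards [eventually_eq_of_isLocalMax_of_harmonicAt (hh w hw.1) hloc, hwU]
      with v hv hvU
    exact ⟨hvU, hv.trans hw.2⟩
  refine (hconn.subset_of_closure_inter_subset hEo ⟨z, hz, hz, hzM⟩ ?_ hw).2
  rintro v ⟨hv, hvU⟩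
  refine ⟨hvU, ?_⟩
  have hcont : ContinuousAt u v := (hh v hvU).1.continuousAt
  have hfreq : ∃ᶠ x in 𝓝 v, u x = M := (mem_closure_iff_frequently.1 hv).mono fun x hx => hx.2
  by_contra hne
  exact hfreq ((hcont.eventually_ne hne).mono fun x hx => hx)

/-- The punctured unit disc. -/
def puncturedDisc : Set ℂ := Metric.ball 0 1 \ {0}

theorem isOpen_puncturedDisc : IsOpen puncturedDisc := Metric.isOpen_ball.sdiff isClosed_singleton

theorem isPreconnected_puncturedDisc : IsPreconnected puncturedDisc := by
  have himg : puncturedDisc = Complex.exp '' {w | w.re < 0} := by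
    ext z
    simp only [puncturedDisc, Set.mem_sdiff, mem_ball_zero_iff, mem_singleton_iff, mem_image]
    constructor
    · rintro ⟨h1, h0⟩
      refine ⟨Complex.log z, ?_, Complex.exp_log h0⟩
      rw [mem_ofPred_eq, Complex.log_re]
      exact Real.log_neg (norm_pos_iff.2 h0) h1
    · rintro ⟨w, hw, rfl⟩
      refine ⟨?_, Complex.exp_ne_zero w⟩
      rw [Complex.norm_exp, ← Real.exp_zero]
      exact Real.exp_lt_exp.2 hw
  rw [himg]
  exact ((convex_halfSpace_re_lt 0).isPreconnected).image _ Complex.continuous_exp.continuousOn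

theorem harmonicAt_log_norm_of_ne_zero {z : ℂ} (hz : z ≠ 0) :
    HarmonicAt (fun w : ℂ => Real.log ‖w‖) z :=
  analyticAt_id.harmonicAt_log_norm hz

theorem continuousOn_log_norm : ContinuousOn (fun w : ℂ => Real.log ‖w‖) {0}ᶜ :=
  fun _ hz => (continuous_norm.continuousAt.log (norm_ne_zero_iff.2 hz)).continuousWithinAt

/-- Closed annuli inside the closed disc. -/
def annulus (r : ℝ) : Set ℂ := Metric.closedBall 0 1 \ Metric.ball 0 r

theorem mem_annulus {r : ℝ} {z : ℂ} : z ∈ annulus r ↔ ‖z‖ ≤ 1 ∧ r ≤ ‖z‖ := by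
  simp [annulus]

theorem isCompact_annulus (r : ℝ) : IsCompact (annulus r) :=
  (isCompact_closedBall _ _).diff Metric.isOpen_ball

/-- Maximum principle for `u + δ log |z|` on an annulus. -/
theorem add_log_le_on_annulus {u : ℂ → ℝ} {r M δ : ℝ} (hr : 0 < r)
    (hc : ContinuousOn u (Metric.closedBall 0 1 \ {0})) (hh : HarmonicOnNhd u puncturedDisc)
    (h1 : ∀ z : ℂ, ‖z‖ = 1 → u z ≤ M) (h2 : ∀ z : ℂ, ‖z‖ = r → r < 1 → u z + δ * Real.log r ≤ M)
    {z : ℂ} (hz : z ∈ annulus r) : u z + δ * Real.log ‖z‖ ≤ M := by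
  have hne : ∀ w ∈ annulus r, w ≠ 0 := by
    intro w hw h0
    have := (mem_annulus.1 hw).2
    rw [h0, norm_zero] at this
    linarith
  refine le_of_harmonicOnNhd_of_le_diff (u := fun w => u w + δ * Real.log ‖w‖)
    (U := {w | r < ‖w‖} ∩ Metric.ball 0 1) (isCompact_annulus r)
    ((isOpen_lt continuous_const continuous_norm).inter Metric.isOpen_ball) ?_ ?_ ?_ ?_ hz
  · rintro w ⟨hw1, hw2⟩
    exact mem_annulus.2 ⟨(mem_ball_zero_iff.1 hw2).le, le_of_lt hw1⟩
  · refine (hc.mono fun w hw => ⟨hw.1, hne w hw⟩).add (continuousOn_const.mul ?_)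
    exact continuousOn_log_norm.mono fun w hw => hne w hw
  · rintro w ⟨hw1, hw2⟩
    have hw0 : w ≠ 0 := norm_pos_iff.1 (hr.trans hw1)
    exact (hh w ⟨hw2, hw0⟩).add
      ((harmonicAt_log_norm_of_ne_zero hw0).const_smul (c := δ))
  · rintro w ⟨hw, hwU⟩
    obtain ⟨hw1, hwr⟩ := mem_annulus.1 hw
    rcases hw1.lt_or_eq with h | h
    · have hwr' : ‖w‖ = r := by
        refine le_antisymm (not_lt.1 fun h' => hwU ⟨h', mem_ball_zero_iff.2 h⟩) hwr
      have := h2 w hwr' (hwr' ▸ h)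
      simpa [hwr'] using this
    · simpa [h] using h1 w h

/-- A point is removable for the maximum principle: `ε log |z|` vanishes on the circle and tends to
`-∞` at `0`, so on a small inner circle it beats the bound `C`; then `ε → 0`. -/
theorem le_of_bounded_harmonic_puncturedDisc {u : ℂ → ℝ} {M C : ℝ}
    (hc : ContinuousOn u (Metric.closedBall 0 1 \ {0})) (hh : HarmonicOnNhd u puncturedDisc)
    (hb : ∀ z ∈ puncturedDisc, u z ≤ C) (h1 : ∀ z : ℂ, ‖z‖ = 1 → u z ≤ M)
    {z : ℂ} (hz : z ∈ puncturedDisc) : u z ≤ M := by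
  have hz0 : 0 < ‖z‖ := norm_pos_iff.2 hz.2
  have hz1 : ‖z‖ < 1 := mem_ball_zero_iff.1 hz.1
  have key : ∀ ε > 0, u z + ε * Real.log ‖z‖ ≤ M := by
    intro ε hε
    have hev : ∀ᶠ r in 𝓝[>] (0 : ℝ), C + ε * Real.log r ≤ M := by
      have ht : Tendsto (fun r : ℝ => C + ε * Real.log r) (𝓝[>] 0) atBot :=
        tendsto_atBot_add_const_left _ _ (Real.tendsto_log_nhdsGT_zero.const_mul_atBot hε)
      exact ht.eventually_le_atBot M
    obtain ⟨r, hr, hr0, hrz⟩ := (hev.and (Ioo_mem_nhdsGT hz0)).exists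
    refine add_log_le_on_annulus hr0 hc hh h1 ?_ (mem_annulus.2 ⟨hz1.le, hrz.le⟩)
    intro w hw hr1
    have := hb w ⟨mem_ball_zero_iff.2 (hw ▸ hr1), norm_pos_iff.1 (hw ▸ hr0)⟩
    linarith
  have ht : Tendsto (fun ε : ℝ => u z + ε * Real.log ‖z‖) (𝓝[>] 0) (𝓝 (u z + 0 * Real.log ‖z‖)) :=
    ((continuous_const.add (continuous_id.mul continuous_const)).tendsto 0).mono_left
      nhdsWithin_le_nhds
  rw [zero_mul, add_zero] at ht
  exact le_of_tendsto ht (eventually_mem_nhdsWithin.mono fun ε hε => key ε hε)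

/-- A bounded harmonic function in the punctured disc whose boundary values are nonpositive
wherever its normal derivative does not vanish is nonpositive. -/
theorem nonpos_of_mixed_boundary {u : ℂ → ℝ} {C : ℝ}
    (hc : ContinuousOn u (Metric.closedBall 0 1 \ {0})) (hh : HarmonicOnNhd u puncturedDisc)
    (hb : ∀ z ∈ puncturedDisc, u z ≤ C)
    (hbd : ∀ ζ : ℂ, ‖ζ‖ = 1 → u ζ ≤ 0 ∨ HasNormalDeriv .interior u ζ 0)
    (hex : ∃ ζ : ℂ, ‖ζ‖ = 1 ∧ u ζ ≤ 0)
    {z : ℂ} (hz : z ∈ Metric.closedBall (0 : ℂ) 1 \ {0}) : u z ≤ 0 := by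
  have hsub : Metric.sphere (0 : ℂ) 1 ⊆ Metric.closedBall 0 1 \ {0} := by
    intro w hw
    refine ⟨Metric.sphere_subset_closedBall hw, ?_⟩
    rintro rfl
    simp at hw
  obtain ⟨ζ₀, hζ₀, hmax⟩ := (isCompact_sphere (0 : ℂ) 1).exists_isMaxOn
    ⟨1, by simp⟩ (hc.mono hsub)
  have hζ₀1 : ‖ζ₀‖ = 1 := by simpa using hζ₀
  set M := u ζ₀ with hMdef
  have h1 : ∀ w : ℂ, ‖w‖ = 1 → u w ≤ M := fun w hw => hmax (by simpa using hw)
  have hle : ∀ w ∈ puncturedDisc, u w ≤ M := fun w hw =>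
    le_of_bounded_harmonic_puncturedDisc hc hh hb h1 hw
  have hle' : u z ≤ M := by
    rcases (mem_closedBall_zero_iff.1 hz.1).lt_or_eq with h | h
    · exact hle z ⟨mem_ball_zero_iff.2 h, hz.2⟩
    · exact h1 z h
  refine hle'.trans ?_
  by_contra! hMpos
  -- Otherwise `u` is the constant `M` inside, and by continuity up to the circle also at the
  -- boundary point where `u ≤ 0`.
  have hstrict : ∀ w ∈ puncturedDisc, u w < M := by
    intro w hw
    refine lt_of_le_of_ne (hle w hw) fun heq => ?_
    have hconst : ∀ v ∈ puncturedDisc, u v = M := fun v hv =>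
      eqOn_of_isPreconnected_of_harmonicOnNhd isOpen_puncturedDisc isPreconnected_puncturedDisc
        hh hle hw heq hv
    obtain ⟨ζ, hζ, hζu⟩ := hex
    have hζmem : ζ ∈ closure puncturedDisc := by
      have h0 : ζ ≠ 0 := norm_ne_zero_iff.1 (by rw [hζ]; exact one_ne_zero)
      have htt : Tendsto (fun t : ℝ => (t : ℂ) * ζ) (𝓝[<] 1) (𝓝 (((1 : ℝ) : ℂ) * ζ)) :=
        (((Complex.continuous_ofReal.mul continuous_const).tendsto 1)).mono_left nhdsWithin_le_nhds
      rw [Complex.ofReal_one, one_mul] at htt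
      refine mem_closure_of_tendsto htt ?_
      filter_upwards [Ioo_mem_nhdsLT (zero_lt_one' ℝ)] with t ht
      refine ⟨?_, ?_⟩
      · simpa [hζ, abs_of_pos ht.1] using ht.2
      · simpa [h0] using ht.1.ne'
    have hcw : ContinuousWithinAt u puncturedDisc ζ :=
      (hc ζ (hsub (by simpa using hζ))).mono fun v hv =>
        ⟨Metric.ball_subset_closedBall hv.1, hv.2⟩
    have hlim : Tendsto u (𝓝[puncturedDisc] ζ) (𝓝 M) :=
      tendsto_const_nhds.congr' (eventually_mem_nhdsWithin.mono fun v hv => (hconst v hv).symm)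
    have := mem_closure_iff_nhdsWithin_neBot.1 hζmem
    have := tendsto_nhds_unique hcw hlim
    linarith
  obtain ⟨z₁, hz₁, hmax₁⟩ := (isCompact_sphere (0 : ℂ) (1 / 2)).exists_isMaxOn
    ⟨1 / 2, by simp⟩ (hc.mono fun w hw => by
      have hw' : ‖w‖ = 1 / 2 := by simpa using hw
      refine ⟨by rw [mem_closedBall_zero_iff, hw']; norm_num, fun h0 => ?_⟩
      rw [mem_singleton_iff.1 h0] at hw'
      norm_num at hw')
  have hmem : ∀ w : ℂ, ‖w‖ = 1 / 2 → w ∈ puncturedDisc := fun w hw =>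
    ⟨by rw [mem_ball_zero_iff, hw]; norm_num, norm_ne_zero_iff.1 (by rw [hw]; norm_num)⟩
  set m := u z₁ with hmdef
  have hmM : m < M := hstrict z₁ (hmem z₁ (by simpa using hz₁))
  -- Chosen so that the barrier `u - δ log |z|` is at most `m + δ log 2 = M` on the circle of radius
  -- `1 / 2`; on the unit circle the logarithm vanishes.
  set δ := (M - m) / Real.log 2 with hδdef
  have hlog2 : 0 < Real.log 2 := Real.log_pos one_lt_two
  have hδ : 0 < δ := div_pos (sub_pos.2 hmM) hlog2
  have hann : ∀ w ∈ annulus (1 / 2), u w + (-δ) * Real.log ‖w‖ ≤ M := by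
    intro w hw
    refine add_log_le_on_annulus (by norm_num) hc hh h1 ?_ hw
    intro v hv _
    have h3 : u v ≤ m := hmax₁ (by simpa using hv)
    have h4 : δ * Real.log 2 = M - m := by rw [hδdef]; field_simp
    rw [one_div, Real.log_inv]
    linarith
  rcases hbd ζ₀ hζ₀1 with h | h
  · linarith
  · unfold HasNormalDeriv at h
    have hsl := (hasDerivWithinAt_iff_tendsto_slope' (s := Iic (0 : ℝ) \ {0})
      (by simp)).1 (h.mono sdiff_subset)
    have hset : Iic (0 : ℝ) \ {0} = Iio 0 := by simp
    rw [hset] at hsl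
    -- The barrier gives `u ((1 + t) ζ₀) ≤ M + δ log (1 + t) ≤ M + δ t`, so for `t < 0` the
    -- difference quotients are at least `δ`, while they tend to `0`.
    have hge : δ ≤ 0 := by
      refine ge_of_tendsto hsl ?_
      filter_upwards [Ioo_mem_nhdsLT (show (-1 / 2 : ℝ) < 0 by norm_num)] with t ht
      have hpt : ζ₀ + (t : ℂ) * outwardNormal .interior ζ₀ = ((1 + t : ℝ) : ℂ) * ζ₀ := by
        simp only [outwardNormal]; push_cast; ring
      have hnorm : ‖((1 + t : ℝ) : ℂ) * ζ₀‖ = 1 + t := by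
        rw [norm_mul, hζ₀1, mul_one, Complex.norm_real, Real.norm_of_nonneg (by linarith [ht.1])]
      have h5 := hann (((1 + t : ℝ) : ℂ) * ζ₀)
        (mem_annulus.2 ⟨by rw [hnorm]; linarith [ht.2], by rw [hnorm]; linarith [ht.1]⟩)
      rw [hnorm] at h5
      have h6 : Real.log (1 + t) ≤ t := by
        have := Real.log_le_sub_one_of_pos (show 0 < 1 + t by linarith [ht.1])
        linarith
      rw [slope_def_field, hpt, le_div_iff_of_neg (by linarith [ht.2])]
      simp only [Complex.ofReal_zero, zero_mul, add_zero, sub_zero]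
      nlinarith
    linarith

end ShapeFactor

/-! ### Radial primitives and products of inverse square roots. -/

namespace ShapeFactor

open scoped Interval
open MeasureTheory ComplexConjugate

/-- The integral of `h` along the segment from `0` to `z`. -/
noncomputable def radialIntegral (h : ℂ → ℂ) (z : ℂ) : ℂ := ∫ t in (0 : ℝ)..1, z * h (t * z)

theorem smul_mem_of_starConvex {Ω : Set ℂ} (hstar : StarConvex ℝ 0 Ω) {z : ℂ} (hz : z ∈ Ω) {t : ℝ}
    (ht : t ∈ Icc (0 : ℝ) 1) : (t : ℂ) * z ∈ Ω := by
  have := hstar.smul_mem hz ht.1 ht.2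
  simpa using this

theorem hasDerivAt_radialIntegral {h : ℂ → ℂ} {Ω : Set ℂ} (hΩ : IsOpen Ω)
    (hstar : StarConvex ℝ 0 Ω) (hh : DifferentiableOn ℂ h Ω) {z : ℂ} (hz : z ∈ Ω) :
    HasDerivAt (radialIntegral h) (h z) z := by
  have hhc := hh.continuousOn
  have hdc : ContinuousOn (deriv h) Ω := (hh.deriv hΩ).continuousOn
  have hhd : ∀ w ∈ Ω, HasDerivAt h (deriv h w) w := fun w hw =>
    (hh.differentiableAt (hΩ.mem_nhds hw)).hasDerivAt
  obtain ⟨ε, hε, hball⟩ := Metric.nhds_basis_closedBall.mem_iff.1 (hΩ.mem_nhds hz)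
  have hmem : ∀ w ∈ Metric.closedBall z ε, ∀ t ∈ Icc (0 : ℝ) 1, (t : ℂ) * w ∈ Ω := fun w hw t ht =>
    smul_mem_of_starConvex hstar (hball hw) ht
  set F' : ℂ → ℝ → ℂ := fun w t => h (t * w) + w * (t * deriv h (t * w)) with hF'
  have hF'c : ContinuousOn (fun p : ℂ × ℝ => F' p.1 p.2) (Metric.closedBall z ε ×ˢ Icc 0 1) := by
    have hm : ContinuousOn (fun p : ℂ × ℝ => (p.2 : ℂ) * p.1)
        (Metric.closedBall z ε ×ˢ Icc 0 1) := by
      fun_prop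
    have hmaps : MapsTo (fun p : ℂ × ℝ => (p.2 : ℂ) * p.1) (Metric.closedBall z ε ×ˢ Icc 0 1) Ω :=
      fun p hp => hmem p.1 hp.1 p.2 hp.2
    have h1 := hhc.comp hm hmaps
    have h2 := hdc.comp hm hmaps
    have h3 : ContinuousOn (fun p : ℂ × ℝ => (p.2 : ℂ)) (Metric.closedBall z ε ×ˢ Icc 0 1) := by
      fun_prop
    exact h1.add (continuousOn_fst.mul (h3.mul h2))
  obtain ⟨B, hB⟩ :=
    ((isCompact_closedBall z ε).prod isCompact_Icc).exists_bound_of_continuousOn hF'c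
  have hIcc : Ι (0 : ℝ) 1 ⊆ Icc 0 1 := by
    rw [uIoc_of_le zero_le_one]; exact Ioc_subset_Icc_self
  have hray : ∀ w ∈ Metric.closedBall z ε, ContinuousOn (fun t : ℝ => h (t * w)) (Icc 0 1) :=
    fun w hw => hhc.comp (by fun_prop) fun t ht => hmem w hw t ht
  have hzz : z ∈ Metric.closedBall z ε := Metric.mem_closedBall_self hε.le
  have hF'z : ContinuousOn (F' z) (Icc 0 1) :=
    hF'c.comp (f := fun t : ℝ => (z, t)) (by fun_prop) fun t ht => ⟨hzz, ht⟩
  have hmain := intervalIntegral.hasDerivAt_integral_of_dominated_loc_of_deriv_le (μ := volume)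
    (F := fun w t => w * h (t * w)) (F' := F') (x₀ := z) (s := Metric.closedBall z ε)
    (a := 0) (b := 1) (bound := fun _ => B) (Metric.closedBall_mem_nhds z hε) ?_ ?_ ?_ ?_ ?_ ?_
  · have hint : ∫ t in (0 : ℝ)..1, F' z t = h z := by
      have := intervalIntegral.integral_eq_sub_of_hasDerivAt
        (f := fun t : ℝ => (t : ℂ) * h (t * z)) (f' := F' z) (a := 0) (b := 1) ?_ ?_
      · simpa using this
      · intro t ht
        rw [uIcc_of_le zero_le_one] at ht
        have h1 : HasDerivAt (fun t : ℝ => (t : ℂ) * z) z t := by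
          simpa using (Complex.ofRealCLM.hasDerivAt (x := t)).mul_const z
        have h2 : HasDerivAt (fun t : ℝ => h (t * z)) (deriv h (t * z) * z) t :=
          HasDerivAt.comp (𝕜' := ℂ) t (hhd _ (hmem z hzz t ht)) h1
        have h3 := (Complex.ofRealCLM.hasDerivAt (x := t)).mul h2
        refine h3.congr_deriv ?_
        simp only [hF', Complex.ofRealCLM_apply, Complex.ofReal_one, one_mul]
        ring
      · exact ContinuousOn.intervalIntegrable (by rwa [uIcc_of_le zero_le_one])
    rw [← hint]
    exact hmain.2
  · filter_upwards [Metric.closedBall_mem_nhds z hε] with w hw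
    exact ((continuousOn_const.mul (hray w hw)).mono hIcc).aestronglyMeasurable measurableSet_uIoc
  · refine ContinuousOn.intervalIntegrable ?_
    rw [uIcc_of_le zero_le_one]
    exact continuousOn_const.mul (hray z hzz)
  · exact (hF'z.mono hIcc).aestronglyMeasurable measurableSet_uIoc
  · exact Eventually.of_forall fun t ht w hw => hB (w, t) ⟨hw, hIcc ht⟩
  · exact intervalIntegrable_const
  · refine Eventually.of_forall fun t ht w hw => ?_
    have h1 : HasDerivAt (fun w : ℂ => (t : ℂ) * w) t w := by
      simpa using (hasDerivAt_id w).const_mul (t : ℂ)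
    have h2 : HasDerivAt (fun w : ℂ => h (t * w)) (deriv h (t * w) * t) w :=
      HasDerivAt.comp w (hhd _ (hmem w hw t (hIcc ht))) h1
    refine ((hasDerivAt_id w).mul h2).congr_deriv ?_
    simp only [hF', id]
    ring

theorem intervalIntegrable_one_sub_rpow :
    IntervalIntegrable (fun t : ℝ => (1 - t) ^ (-(1 / 2) : ℝ)) volume 0 1 := by
  have := (intervalIntegral.intervalIntegrable_rpow' (a := 0) (b := 1)
    (show (-1 : ℝ) < -(1 / 2) by norm_num)).comp_sub_left 1
  simpa using this.symm

/-- A function that blows up at most like an inverse square root at the unit circle has a radial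
primitive that is continuous up to the circle. -/
theorem continuousOn_radialIntegral {h : ℂ → ℂ} {B : ℝ} (hh : ContinuousOn h (Metric.ball 0 1))
    (hB : ∀ z ∈ Metric.closedBall (0 : ℂ) 1, ∀ t ∈ Ico (0 : ℝ) 1,
      ‖h (t * z)‖ ≤ B * (1 - t) ^ (-(1 / 2) : ℝ)) :
    ContinuousOn (radialIntegral h) (Metric.closedBall 0 1) := by
  have hmem : ∀ z ∈ Metric.closedBall (0 : ℂ) 1, ∀ t ∈ Ico (0 : ℝ) 1,
      (t : ℂ) * z ∈ Metric.ball (0 : ℂ) 1 := by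
    intro z hz t ht
    rw [mem_closedBall_zero_iff] at hz
    rw [mem_ball_zero_iff, norm_mul, Complex.norm_real, Real.norm_of_nonneg ht.1]
    nlinarith [ht.1, ht.2, norm_nonneg z]
  have hIoo : Ι (0 : ℝ) 1 = Ioc 0 1 := uIoc_of_le zero_le_one
  -- At `t = 1` the point `t * z` may lie on the circle, where nothing is assumed about `h`; that
  -- endpoint is a null set.
  have hne : ∀ᵐ t : ℝ, t ≠ 1 := by simp [ae_iff, measure_singleton]
  intro z₀ hz₀
  refine intervalIntegral.continuousWithinAt_of_dominated_interval
    (bound := fun t => B * (1 - t) ^ (-(1 / 2) : ℝ)) ?_ ?_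
    (intervalIntegrable_one_sub_rpow.const_mul B) ?_
  · filter_upwards [self_mem_nhdsWithin] with z hz
    rw [hIoo, ← Measure.restrict_congr_set Ioo_ae_eq_Ioc]
    refine ContinuousOn.aestronglyMeasurable ?_ measurableSet_Ioo
    exact continuousOn_const.mul (hh.comp (by fun_prop) fun t ht => hmem z hz t ⟨ht.1.le, ht.2⟩)
  · filter_upwards [self_mem_nhdsWithin] with z hz
    filter_upwards [hne] with t ht1 ht
    rw [hIoo] at ht
    have htt : t ∈ Ico (0 : ℝ) 1 := ⟨ht.1.le, lt_of_le_of_ne ht.2 ht1⟩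
    rw [norm_mul]
    refine (mul_le_of_le_one_left (norm_nonneg _) (mem_closedBall_zero_iff.1 hz)).trans ?_
    exact hB z hz t htt
  · filter_upwards [hne] with t ht1 ht
    rw [hIoo] at ht
    have htt : t ∈ Ico (0 : ℝ) 1 := ⟨ht.1.le, lt_of_le_of_ne ht.2 ht1⟩
    refine continuousWithinAt_id.mul ?_
    have hca : ContinuousAt h (t * z₀) :=
      hh.continuousAt (Metric.isOpen_ball.mem_nhds (hmem z₀ hz₀ t htt))
    exact (ContinuousAt.comp (f := fun z : ℂ => (t : ℂ) * z) hca (by fun_prop)).continuousWithinAt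

section RootProduct

variable {ι : Type*}

/-- The plane slit along the rays from the points `a j` of the unit circle to infinity. -/
def slitDomain (a : ι → ℂ) : Set ℂ := {z | ∀ j, 1 - z * conj (a j) ∈ Complex.slitPlane}

/-- The branch on `slitDomain a` of the inverse square root of `∏ j, (1 - z / a j)`. -/
noncomputable def rootProduct [Fintype ι] (a : ι → ℂ) (z : ℂ) : ℂ :=
  ∏ j, (1 - z * conj (a j)) ^ (-(1 / 2) : ℂ)

theorem isOpen_slitDomain [Finite ι] (a : ι → ℂ) : IsOpen (slitDomain a) := by
  simp only [slitDomain, ofPred_forall]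
  exact isOpen_iInter_of_finite fun j => Complex.isOpen_slitPlane.preimage (by fun_prop)

/-- The slit plane is star-shaped about `1`, and `z ↦ 1 - z * conj (a j)` is affine and sends `0` to
`1`. This makes radial primitives available on the whole slit domain. -/
theorem starConvex_slitDomain (a : ι → ℂ) : StarConvex ℝ 0 (slitDomain a) := by
  rw [starConvex_zero_iff]
  intro z hz t ht0 ht1 j
  have := StarConvex.add_smul_mem (x := (1 : ℂ)) (y := -(z * conj (a j)))
    Complex.starConvex_one_slitPlane (by simpa [sub_eq_add_neg] using hz j) ht0 ht1
  convert this using 1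
  simp only [Complex.real_smul]
  ring

/-- A number of modulus at most `1` has real part `1` only if it equals `1`. Hence primitives on the
slit domain are holomorphic across the open arcs, which is where normal derivatives are taken. -/
theorem mem_slitDomain {a : ι → ℂ} (ha : ∀ j, ‖a j‖ = 1) {z : ℂ} (hz : ‖z‖ ≤ 1)
    (hza : ∀ j, z ≠ a j) : z ∈ slitDomain a := by
  intro j
  left
  have hn : ‖z * conj (a j)‖ ≤ 1 := by simpa [ha j] using hz
  by_contra! hre
  have h1 : 1 ≤ (z * conj (a j)).re := by simpa using hre
  have h2 : (z * conj (a j)).re = 1 := le_antisymm ((Complex.re_le_norm _).trans hn) h1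
  have h3 : (z * conj (a j)).im = 0 := by
    have h4 := Complex.normSq_apply (z * conj (a j))
    rw [Complex.normSq_eq_norm_sq, h2] at h4
    nlinarith [norm_nonneg (z * conj (a j))]
  have h5 : z * conj (a j) = 1 := Complex.ext (by simpa using h2) (by simpa using h3)
  have h6 : conj (a j) * a j = 1 := by
    rw [mul_comm, Complex.mul_conj, Complex.normSq_eq_norm_sq, ha j]; simp
  apply hza j
  calc z = z * (conj (a j) * a j) := by rw [h6, mul_one]
    _ = a j := by rw [← mul_assoc, h5, one_mul]

theorem ball_subset_slitDomain {a : ι → ℂ} (ha : ∀ j, ‖a j‖ = 1) :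
    Metric.ball 0 1 ⊆ slitDomain a := by
  intro z hz
  rw [mem_ball_zero_iff] at hz
  exact mem_slitDomain ha hz.le fun j h => by rw [h, ha j] at hz; exact lt_irrefl _ hz

theorem differentiableOn_rootProduct [Fintype ι] (a : ι → ℂ) :
    DifferentiableOn ℂ (rootProduct a) (slitDomain a) := by
  intro z hz
  unfold rootProduct
  refine DifferentiableWithinAt.fun_finsetProd fun j _ => ?_
  exact (DifferentiableAt.cpow_const (f := fun z => 1 - z * conj (a j)) (by fun_prop)
    (hz j)).differentiableWithinAt

theorem rootProduct_ne_zero [Fintype ι] {a : ι → ℂ} {z : ℂ} (hz : z ∈ slitDomain a) :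
    rootProduct a z ≠ 0 := by
  refine Finset.prod_ne_zero_iff.2 fun j _ => ?_
  rw [Complex.cpow_def_of_ne_zero (Complex.slitPlane_ne_zero (hz j))]
  exact Complex.exp_ne_zero _

/-- Squaring erases the branch. The identity survives at the singular points, where both sides are
`0` by convention. -/
theorem rootProduct_sq [Fintype ι] (a : ι → ℂ) (z : ℂ) :
    rootProduct a z ^ 2 = (∏ j, (1 - z * conj (a j)))⁻¹ := by
  rw [rootProduct, ← Finset.prod_pow, ← Finset.prod_inv_distrib]
  refine Finset.prod_congr rfl fun j _ => ?_
  rw [← Complex.cpow_nat_mul, ← Complex.cpow_neg_one]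
  norm_num

theorem norm_one_sub_mul_conj {a z : ℂ} (ha : ‖a‖ = 1) : ‖1 - z * conj a‖ = ‖z - a‖ := by
  have h6 : a * conj a = 1 := by
    rw [Complex.mul_conj, Complex.normSq_eq_norm_sq, ha]; simp
  calc ‖1 - z * conj a‖ = ‖(a - z) * conj a‖ := by rw [sub_mul, h6]
    _ = ‖z - a‖ := by rw [norm_mul, Complex.norm_conj, ha, mul_one, norm_sub_rev]

theorem norm_rootProduct [Fintype ι] {a : ι → ℂ} (ha : ∀ j, ‖a j‖ = 1) (z : ℂ) :
    ‖rootProduct a z‖ = ∏ j, ‖z - a j‖ ^ (-(1 / 2) : ℝ) := by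
  rw [rootProduct, norm_prod]
  refine Finset.prod_congr rfl fun j _ => ?_
  rw [← norm_one_sub_mul_conj (ha j), ← Complex.norm_cpow_real]
  norm_num

/-- Distinct singularities do not interact: the product is bounded by a multiple of the sum. -/
theorem exists_norm_rootProduct_le [Fintype ι] [Nonempty ι] {a : ι → ℂ} (ha : ∀ j, ‖a j‖ = 1)
    (hinj : Function.Injective a) :
    ∃ B : ℝ, 0 ≤ B ∧ ∀ z, ‖rootProduct a z‖ ≤ B * ∑ j, ‖z - a j‖ ^ (-(1 / 2) : ℝ) := by
  classical
  have hδ : ∀ᶠ δ in 𝓝[>] (0 : ℝ), ∀ i j, i ≠ j → 2 * δ ≤ ‖a i - a j‖ := by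
    refine eventually_all.2 fun i => eventually_all.2 fun j => ?_
    by_cases hij : i = j
    · simp [hij]
    · have : 0 < ‖a i - a j‖ / 2 := half_pos (norm_pos_iff.2 (sub_ne_zero.2 (hinj.ne hij)))
      filter_upwards [Ioo_mem_nhdsGT this] with δ hδ _
      linarith [hδ.2]
  obtain ⟨δ, hδ, hδ0⟩ := (hδ.and self_mem_nhdsWithin).exists
  have hδ0 : 0 < δ := hδ0
  refine ⟨∏ _j ∈ (Finset.univ : Finset ι).erase (Classical.arbitrary ι), δ ^ (-(1 / 2) : ℝ),
    by positivity, fun z => ?_⟩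
  -- Only the singularity nearest to `z` can be closer than `δ`. The factors from all others are
  -- bounded by a constant depending only on their number, so the index erased in it is immaterial.
  obtain ⟨i, hi⟩ := Finite.exists_min fun j => ‖z - a j‖
  have hfar : ∀ j, j ≠ i → δ ≤ ‖z - a j‖ := by
    intro j hj
    have h1 := hδ j i hj
    have h2 : ‖a j - a i‖ ≤ ‖z - a j‖ + ‖z - a i‖ := by
      calc ‖a j - a i‖ = ‖(z - a i) - (z - a j)‖ := by congr 1; ring
        _ ≤ _ := by rw [add_comm]; exact norm_sub_le _ _
    linarith [hi j]
  rw [norm_rootProduct ha, ← Finset.mul_prod_erase _ _ (Finset.mem_univ i), mul_comm]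
  refine mul_le_mul ?_ ?_ (by positivity) (by positivity)
  · calc ∏ j ∈ Finset.univ.erase i, ‖z - a j‖ ^ (-(1 / 2) : ℝ)
        ≤ ∏ _j ∈ Finset.univ.erase i, δ ^ (-(1 / 2) : ℝ) := by
          refine Finset.prod_le_prod (fun j _ => by positivity) fun j hj => ?_
          exact Real.rpow_le_rpow_of_nonpos hδ0 (hfar j (Finset.ne_of_mem_erase hj)) (by norm_num)
      _ = _ := by
          rw [Finset.prod_const, Finset.prod_const, Finset.card_erase_of_mem (Finset.mem_univ _),
            Finset.card_erase_of_mem (Finset.mem_univ _)]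
  · exact Finset.single_le_sum (f := fun j => ‖z - a j‖ ^ (-(1 / 2) : ℝ))
      (fun j _ => by positivity) (Finset.mem_univ i)

end RootProduct

theorem norm_circlePt (θ : ℝ) : ‖circlePt θ‖ = 1 := Complex.norm_exp_ofReal_mul_I θ

theorem circlePt_add (θ φ : ℝ) : circlePt (θ + φ) = circlePt θ * circlePt φ := by
  simp only [circlePt]
  rw [← Complex.exp_add]
  push_cast
  ring_nf

theorem continuous_circlePt : Continuous circlePt := by unfold circlePt; fun_prop

theorem norm_circlePt_sub_one (x : ℝ) : ‖circlePt x - 1‖ = 2 * |Real.sin (x / 2)| := by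
  have := Complex.norm_exp_I_mul_ofReal_sub_one x
  rw [circlePt, mul_comm, this]
  simp

/-- By rotation and periodicity it suffices to treat `α = 0` on `[-π, π]`, where the chord `2 |sin
(x / 2)|` is at least `(2 / π) |x|` and the exponent exceeds `-1`. -/
theorem intervalIntegrable_norm_circlePt_sub_rpow (α a b : ℝ) :
    IntervalIntegrable (fun θ => ‖circlePt θ - circlePt α‖ ^ (-(1 / 2) : ℝ)) volume a b := by
  have h0 : ∀ θ, ‖circlePt θ - circlePt α‖ = ‖circlePt (θ - α) - 1‖ := by
    intro θ
    have : circlePt θ - circlePt α = circlePt α * (circlePt (θ - α) - 1) := by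
      rw [mul_sub, ← circlePt_add, mul_one]; congr 2; ring
    rw [this, norm_mul, norm_circlePt, one_mul]
  simp only [h0]
  suffices H : ∀ a b, IntervalIntegrable (fun x => ‖circlePt x - 1‖ ^ (-(1 / 2) : ℝ)) volume a b by
    simpa using (H (a - α) (b - α)).comp_sub_right α
  have hper : Function.Periodic (fun x => ‖circlePt x - 1‖ ^ (-(1 / 2) : ℝ)) (2 * Real.pi) := by
    intro x
    have : circlePt (x + 2 * Real.pi) = circlePt x := by
      rw [circlePt_add]
      simp [circlePt, Complex.exp_two_pi_mul_I]
    simp only [this]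
  intro a b
  refine hper.intervalIntegrable (t := -Real.pi) Real.two_pi_pos.ne' ?_ a b
  have hbound : IntervalIntegrable
      (fun x : ℝ => (2 / Real.pi) ^ (-(1 / 2) : ℝ) * |x| ^ (-(1 / 2) : ℝ))
      volume (-Real.pi) (-Real.pi + 2 * Real.pi) := by
    refine IntervalIntegrable.const_mul ?_ _
    have hpos : ∀ c : ℝ, 0 ≤ c →
        IntervalIntegrable (fun x : ℝ => |x| ^ (-(1 / 2) : ℝ)) volume 0 c := by
      intro c hc
      refine (intervalIntegral.intervalIntegrable_rpow' (a := 0) (b := c)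
        (show (-1 : ℝ) < -(1 / 2) by norm_num)).congr ?_
      intro x hx
      rw [uIoc_of_le hc] at hx
      simp only [abs_of_pos hx.1]
    have h1 := hpos Real.pi Real.pi_pos.le
    have h2 : IntervalIntegrable (fun x : ℝ => |x| ^ (-(1 / 2) : ℝ)) volume (-Real.pi) 0 := by
      simpa using (h1.comp_sub_left 0).symm
    have h3 : -Real.pi + 2 * Real.pi = Real.pi := by ring
    rw [h3]
    exact h2.trans h1
  refine hbound.mono_fun ?_ ?_
  · refine Measurable.aestronglyMeasurable ?_
    exact ((continuous_circlePt.sub continuous_const).norm.measurable).pow_const _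
  · refine (ae_restrict_iff' measurableSet_uIoc).2 (Eventually.of_forall fun x hx => ?_)
    rw [uIoc_of_le (by linarith [Real.pi_pos])] at hx
    have hx' : |x / 2| ≤ Real.pi / 2 := by
      rw [abs_le]; constructor <;> linarith [hx.1, hx.2]
    beta_reduce
    rw [Real.norm_of_nonneg (by positivity), Real.norm_of_nonneg (by positivity),
      norm_circlePt_sub_one]
    -- At `x = 0` both sides contain `0 ^ (-1 / 2)`, which is `0` by convention.
    rcases eq_or_ne x 0 with rfl | hx0
    · simp
    rw [← Real.mul_rpow (by positivity) (by positivity)]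
    have hpi := Real.pi_pos
    refine Real.rpow_le_rpow_of_nonpos (by positivity) ?_ (by norm_num)
    have := Real.mul_abs_le_abs_sin hx'
    rw [abs_div, abs_two] at this
    calc 2 / Real.pi * |x| = 2 * (2 / Real.pi * (|x| / 2)) := by ring
      _ ≤ _ := by linarith

end ShapeFactor

/-! ### Arcs on the circle and densities that are real or imaginary there. -/

namespace ShapeFactor

open MeasureTheory ComplexConjugate

theorem circlePt_eq_circlePt_iff {θ φ : ℝ} :
    circlePt θ = circlePt φ ↔ ∃ k : ℤ, θ = φ + k * (2 * Real.pi) := by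
  rw [circlePt, circlePt, Complex.exp_eq_exp_iff_exists_int]
  refine exists_congr fun k => ?_
  have h : (φ : ℂ) * Complex.I + k * (2 * Real.pi * Complex.I)
      = ((φ + k * (2 * Real.pi) : ℝ) : ℂ) * Complex.I := by push_cast; ring
  rw [h, mul_left_inj' Complex.I_ne_zero, Complex.ofReal_inj]

theorem conj_circlePt (θ : ℝ) : conj (circlePt θ) = circlePt (-θ) := by
  rw [circlePt, circlePt, ← Complex.exp_conj]
  simp

theorem circlePt_ne_zero (θ : ℝ) : circlePt θ ≠ 0 := Complex.exp_ne_zero _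

theorem circlePt_mul_neg (θ : ℝ) : circlePt θ * circlePt (-θ) = 1 := by
  rw [← circlePt_add]
  simp [circlePt]

theorem circlePt_add_circlePt_neg (θ : ℝ) : circlePt θ + circlePt (-θ) = 2 * (Real.cos θ : ℂ) := by
  rw [Complex.ofReal_cos, Complex.two_cos, circlePt, circlePt]
  simp

theorem exists_circlePt_eq {ζ : ℂ} (hζ : ‖ζ‖ = 1) : ∃ θ, circlePt θ = ζ := by
  refine ⟨ζ.arg, ?_⟩
  have := Complex.norm_mul_exp_arg_mul_I ζ
  rwa [hζ, Complex.ofReal_one, one_mul] at this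

theorem hasDerivAt_circlePt (θ : ℝ) : HasDerivAt circlePt (circlePt θ * Complex.I) θ := by
  have h1 : HasDerivAt (fun t : ℝ => (t : ℂ) * Complex.I) Complex.I θ := by
    simpa using (Complex.ofRealCLM.hasDerivAt (x := θ)).mul_const Complex.I
  exact h1.cexp

namespace Arrangement

variable (P : Arrangement)

/-- All arcs fit within one turn, so two of their angles never differ by a nonzero multiple of `2π`;
distinct arcs are disjoint as intervals. -/
theorem eq_of_circlePt_eq {i j : Fin P.n} {θ φ : ℝ} (hθ : θ ∈ Icc (P.lo i) (P.hi i))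
    (hφ : φ ∈ Icc (P.lo j) (P.hi j)) (h : circlePt θ = circlePt φ) : i = j ∧ θ = φ := by
  obtain ⟨k, hk⟩ := circlePt_eq_circlePt_iff.1 h
  have h1 := P.hi_lt_turn i j
  have h2 := P.hi_lt_turn j i
  have hπ := Real.two_pi_pos
  have hk1 : (k : ℝ) < 1 := by
    by_contra! hc
    nlinarith [hθ.1, hθ.2, hφ.1, hφ.2]
  have hk2 : (-1 : ℝ) < k := by
    by_contra! hc
    nlinarith [hθ.1, hθ.2, hφ.1, hφ.2]
  have hk0 : k = 0 := by
    have h3 : k < 1 := by exact_mod_cast hk1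
    have h4 : -1 < k := by exact_mod_cast hk2
    omega
  have hθφ : θ = φ := by simpa [hk0] using hk
  refine ⟨?_, hθφ⟩
  rcases lt_trichotomy i j with hij | hij | hij
  · have := P.hi_lt_lo i j hij
    linarith [hθ.1, hθ.2, hφ.1, hφ.2]
  · exact hij
  · have := P.hi_lt_lo j i hij
    linarith [hθ.1, hθ.2, hφ.1, hφ.2]

/-- The endpoints of the isothermal arcs. -/
noncomputable def endpoint (p : Fin P.n × Bool) : ℂ := circlePt (if p.2 then P.hi p.1 else P.lo p.1)

theorem norm_endpoint (p : Fin P.n × Bool) : ‖P.endpoint p‖ = 1 := norm_circlePt _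

theorem endpointAngle_mem (p : Fin P.n × Bool) :
    (if p.2 then P.hi p.1 else P.lo p.1) ∈ Icc (P.lo p.1) (P.hi p.1) := by
  have := (P.lo_lt_hi p.1).le
  split_ifs
  · exact right_mem_Icc.2 this
  · exact left_mem_Icc.2 this

theorem injective_endpoint : Function.Injective P.endpoint := by
  rintro ⟨i, b⟩ ⟨j, b'⟩ h
  obtain ⟨rfl, h2⟩ := P.eq_of_circlePt_eq (P.endpointAngle_mem (i, b))
    (P.endpointAngle_mem (j, b')) h
  have := P.lo_lt_hi i
  cases b <;> cases b' <;> simp_all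

/-- This keeps the natural-number subtractions `n - 1` and `n - 2` honest. -/
theorem n_ge_two : 2 ≤ P.n := by
  obtain ⟨i, hi⟩ := P.exists_hot
  obtain ⟨j, hj⟩ := P.exists_cold
  by_contra! hlt
  have : i = j := Fin.ext (by omega)
  exact hj (this ▸ hi)

/-- A function of the angle that is negative inside the `i`-th arc, zero at its endpoints, and
positive off the arc. -/
noncomputable def arcSign (i : Fin P.n) (θ : ℝ) : ℝ :=
  Real.cos ((P.hi i - P.lo i) / 2) - Real.cos (θ - (P.lo i + P.hi i) / 2)

theorem arcSign_neg {i : Fin P.n} {θ : ℝ} (hθ : θ ∈ Ioo (P.lo i) (P.hi i)) : P.arcSign i θ < 0 := by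
  have h1 := P.hi_lt_turn i i
  rw [arcSign, sub_neg, ← Real.cos_abs (θ - _)]
  refine Real.cos_lt_cos_of_nonneg_of_le_pi (abs_nonneg _) (by linarith) ?_
  rw [abs_lt]
  constructor <;> linarith [hθ.1, hθ.2]

/-- Shift the angle by full turns to within `π` of the midpoint of the arc; there the cosine
decreases with the distance from the midpoint. -/
theorem exists_mem_arc_of_arcSign_nonpos {i : Fin P.n} {θ : ℝ} (h : P.arcSign i θ ≤ 0) :
    ∃ φ ∈ Icc (P.lo i) (P.hi i), circlePt φ = circlePt θ := by
  have h1 := P.lo_lt_hi i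
  obtain ⟨k, hk, -⟩ := existsUnique_add_zsmul_mem_Ico Real.two_pi_pos θ
    ((P.lo i + P.hi i) / 2 - Real.pi)
  rw [zsmul_eq_mul] at hk
  refine ⟨θ + k * (2 * Real.pi), ?_, circlePt_eq_circlePt_iff.2 ⟨k, rfl⟩⟩
  set φ := θ + k * (2 * Real.pi) with hφ
  have hcos : Real.cos (θ - (P.lo i + P.hi i) / 2) = Real.cos |φ - (P.lo i + P.hi i) / 2| := by
    rw [Real.cos_abs, hφ, show θ + k * (2 * Real.pi) - (P.lo i + P.hi i) / 2
      = (θ - (P.lo i + P.hi i) / 2) + k * (2 * Real.pi) by ring, Real.cos_add_int_mul_two_pi]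
  have habs : |φ - (P.lo i + P.hi i) / 2| ≤ (P.hi i - P.lo i) / 2 := by
    by_contra! hlt
    have h2 : |φ - (P.lo i + P.hi i) / 2| ≤ Real.pi := by
      rw [abs_le]; constructor <;> linarith [hk.1, hk.2]
    have := Real.cos_lt_cos_of_nonneg_of_le_pi (by linarith) h2 hlt
    rw [arcSign, hcos] at h
    linarith
  rw [abs_le] at habs
  constructor <;> linarith [habs.1, habs.2]

/-- The isothermal part of the circle is the union of all arcs. -/
theorem mem_isothermal_iff {ζ : ℂ} :
    ζ ∈ P.hot ∪ P.cold ↔ ∃ i, ∃ θ ∈ Icc (P.lo i) (P.hi i), circlePt θ = ζ := by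
  simp only [hot, cold, mem_union, mem_iUnion, mem_image, exists_prop]
  constructor
  · rintro (⟨i, _, h⟩ | ⟨i, _, h⟩) <;> exact ⟨i, h⟩
  · rintro ⟨i, h⟩
    by_cases hi : P.isHot i
    · exact Or.inl ⟨i, hi, h⟩
    · exact Or.inr ⟨i, hi, h⟩

theorem adiabatic_arcSign_pos {θ : ℝ} (h : circlePt θ ∈ P.adiabatic) (i : Fin P.n) :
    0 < P.arcSign i θ := by
  by_contra! hle
  obtain ⟨φ, hφ, hφθ⟩ := P.exists_mem_arc_of_arcSign_nonpos hle
  exact h.2 (P.mem_isothermal_iff.2 ⟨i, φ, hφ, hφθ⟩)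

theorem adiabatic_ne_endpoint {ζ : ℂ} (h : ζ ∈ P.adiabatic) (p : Fin P.n × Bool) :
    ζ ≠ P.endpoint p := by
  rintro rfl
  exact h.2 (P.mem_isothermal_iff.2 ⟨p.1, _, P.endpointAngle_mem p, rfl⟩)

theorem arc_ne_endpoint {i : Fin P.n} {θ : ℝ} (hθ : θ ∈ Ioo (P.lo i) (P.hi i))
    (p : Fin P.n × Bool) : circlePt θ ≠ P.endpoint p := by
  intro h
  obtain ⟨rfl, h2⟩ := P.eq_of_circlePt_eq (Ioo_subset_Icc_self hθ) (P.endpointAngle_mem p) h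
  rw [h2] at hθ
  split_ifs at hθ
  · exact lt_irrefl _ hθ.2
  · exact lt_irrefl _ hθ.1

theorem prod_arcSign_neg {i : Fin P.n} {θ : ℝ} (hθ : θ ∈ Ioo (P.lo i) (P.hi i)) :
    ∏ j, P.arcSign j θ < 0 := by
  rw [← Finset.mul_prod_erase _ _ (Finset.mem_univ i)]
  refine mul_neg_of_neg_of_pos (P.arcSign_neg hθ) (Finset.prod_pos fun j hj => ?_)
  by_contra! hle
  obtain ⟨φ, hφ, hφθ⟩ := P.exists_mem_arc_of_arcSign_nonpos hle
  exact Finset.ne_of_mem_erase hj (P.eq_of_circlePt_eq hφ (Ioo_subset_Icc_self hθ) hφθ).1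

/-- With midpoint `m`, half-width `w` and `u = circlePt (θ - m)`, the left side is `1 - 2 u cos w +
u ^ 2 = u (2 cos (θ - m) - 2 cos w)`. The two endpoints of an arc thus combine into a unimodular
factor times a real one. -/
theorem one_sub_mul_one_sub (i : Fin P.n) (θ : ℝ) :
    (1 - circlePt θ * conj (P.endpoint (i, true))) * (1 - circlePt θ * conj (P.endpoint (i, false)))
      = circlePt θ * circlePt (-((P.lo i + P.hi i) / 2)) * (-2 * (P.arcSign i θ : ℂ)) := by
  set m := (P.lo i + P.hi i) / 2 with hm
  set w := (P.hi i - P.lo i) / 2 with hw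
  have h1 : circlePt θ * conj (P.endpoint (i, true)) = circlePt (θ - m) * circlePt (-w) := by
    simp only [endpoint, if_true]
    rw [conj_circlePt, ← circlePt_add, ← circlePt_add]
    congr 1
    rw [hm, hw]; ring
  have h2 : circlePt θ * conj (P.endpoint (i, false)) = circlePt (θ - m) * circlePt w := by
    simp only [endpoint, Bool.false_eq_true, if_false]
    rw [conj_circlePt, ← circlePt_add, ← circlePt_add]
    congr 1
    rw [hm, hw]; ring
  have h3 : circlePt θ * circlePt (-m) = circlePt (θ - m) := by
    rw [← circlePt_add, sub_eq_add_neg]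
  rw [h1, h2, h3, arcSign, ← hm, ← hw]
  have e1 := circlePt_add_circlePt_neg (θ - m)
  have e2 := circlePt_add_circlePt_neg w
  have e3 := circlePt_mul_neg (θ - m)
  have e4 := circlePt_mul_neg w
  push_cast at e1 e2 ⊢
  linear_combination (circlePt (θ - m)) ^ 2 * e4 - circlePt (θ - m) * e2 +
    circlePt (θ - m) * e1 - e3

/-- The factor that makes the boundary values of `basisDensity` real or imaginary. -/
noncomputable def phase : ℂ :=
  (-((-2) ^ P.n * ∏ i, circlePt (-((P.lo i + P.hi i) / 2)))) ^ (1 / 2 : ℂ)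

theorem phase_sq : P.phase ^ 2 = -((-2) ^ P.n * ∏ i, circlePt (-((P.lo i + P.hi i) / 2))) := by
  rw [phase, ← Complex.cpow_nat_mul]
  norm_num

theorem phase_ne_zero : P.phase ≠ 0 := by
  intro h
  have h2 := P.phase_sq
  rw [h, zero_pow two_ne_zero, eq_comm, neg_eq_zero] at h2
  refine mul_ne_zero (pow_ne_zero _ (by norm_num)) ?_ h2
  exact Finset.prod_ne_zero_iff.2 fun i _ => circlePt_ne_zero _

/-- The polynomial part of `basisDensity`. -/
noncomputable def basisPoly (a : ℕ) (z : ℂ) : ℂ :=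
  (-(Complex.I * (z - 1))) ^ a * (z + 1) ^ (P.n - 2 - a)

/-- The derivatives of the analytic functions whose real parts are constant on the isothermal arcs
and have vanishing normal derivative on the adiabatic ones. -/
noncomputable def basisDensity (a : ℕ) (z : ℂ) : ℂ :=
  P.phase * P.basisPoly a z * rootProduct P.endpoint z

/-- The squares of `-I (ζ - 1)` and `ζ + 1` are `ζ` times nonnegative reals, so `basisPoly`
contributes `ζ ^ (n - 2)`. With the outer `ζ ^ 2` this cancels the `ζ ^ n` from the endpoint
product, and `phase` cancels the remaining constants, leaving the sign `-1`. The square is thus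
nonnegative inside arcs, where exactly one `arcSign` is negative, and nonpositive on the adiabatic
part. -/
theorem exists_basisDensity_sq {a : ℕ} (ha : a ≤ P.n - 2) (θ : ℝ) :
    ∃ s : ℝ, 0 ≤ s ∧ (circlePt θ * P.basisDensity a (circlePt θ)) ^ 2
      = ((-(s * (∏ i, P.arcSign i θ)⁻¹) : ℝ) : ℂ) := by
  have hn := P.n_ge_two
  set ζ := circlePt θ with hζ
  have hζ0 : ζ ≠ 0 := circlePt_ne_zero θ
  have hcos : ζ ^ 2 + 1 = ζ * (2 * (Real.cos θ : ℂ)) := by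
    rw [← circlePt_add_circlePt_neg θ, mul_add, circlePt_mul_neg, pow_two]
  have h1 : (-(Complex.I * (ζ - 1))) ^ 2 = ζ * ((2 - 2 * Real.cos θ : ℝ) : ℂ) := by
    push_cast at hcos ⊢
    linear_combination (ζ - 1) ^ 2 * Complex.I_sq - hcos
  have h2 : (ζ + 1) ^ 2 = ζ * ((2 + 2 * Real.cos θ : ℝ) : ℂ) := by
    push_cast at hcos ⊢
    linear_combination hcos
  have h3 : P.basisPoly a ζ ^ 2 = ζ ^ (P.n - 2)
      * (((2 - 2 * Real.cos θ) ^ a * (2 + 2 * Real.cos θ) ^ (P.n - 2 - a) : ℝ) : ℂ) := by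
    obtain ⟨b, hb⟩ := Nat.exists_eq_add_of_le ha
    rw [basisPoly, mul_pow, ← pow_mul, ← pow_mul, mul_comm a, mul_comm (P.n - 2 - a), pow_mul,
      pow_mul, h1, h2, hb, Nat.add_sub_cancel_left]
    push_cast
    rw [mul_pow, mul_pow, pow_add]
    ring
  have h4 : rootProduct P.endpoint ζ ^ 2
      = (ζ ^ P.n * (∏ i, circlePt (-((P.lo i + P.hi i) / 2))) * (-2) ^ P.n
          * ((∏ i, P.arcSign i θ : ℝ) : ℂ))⁻¹ := by
    rw [rootProduct_sq, Fintype.prod_prod_type]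
    simp only [Fintype.prod_bool]
    rw [Finset.prod_congr rfl fun i _ => P.one_sub_mul_one_sub i θ, Finset.prod_mul_distrib,
      Finset.prod_mul_distrib, Finset.prod_mul_distrib, Finset.prod_const, Finset.prod_const,
      Finset.card_univ, Fintype.card_fin, Complex.ofReal_prod, ← mul_assoc]
  refine ⟨(2 - 2 * Real.cos θ) ^ a * (2 + 2 * Real.cos θ) ^ (P.n - 2 - a), ?_, ?_⟩
  · have := Real.cos_le_one θ
    have := Real.neg_one_le_cos θ
    have h5 : 0 ≤ 2 - 2 * Real.cos θ := by linarith
    have h6 : 0 ≤ 2 + 2 * Real.cos θ := by linarith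
    positivity
  · have hE : (∏ i, circlePt (-((P.lo i + P.hi i) / 2))) ≠ 0 :=
      Finset.prod_ne_zero_iff.2 fun i _ => circlePt_ne_zero _
    have h2n : ((-2 : ℂ)) ^ P.n ≠ 0 := pow_ne_zero _ (by norm_num)
    have hpow : ζ ^ P.n = ζ ^ 2 * ζ ^ (P.n - 2) := by rw [← pow_add]; congr 1; omega
    rw [basisDensity, mul_pow, mul_pow, mul_pow, P.phase_sq, h3, h4, hpow, mul_inv, mul_inv,
      mul_inv, mul_inv, Complex.ofReal_neg, Complex.ofReal_mul _ (_⁻¹), Complex.ofReal_inv]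
    have hζn : ζ ^ (P.n - 2) ≠ 0 := pow_ne_zero _ hζ0
    generalize ((∏ i, P.arcSign i θ : ℝ) : ℂ)⁻¹ = D
    generalize (((2 - 2 * Real.cos θ) ^ a * (2 + 2 * Real.cos θ) ^ (P.n - 2 - a) : ℝ) : ℂ) = s
    field_simp

theorem im_eq_zero_of_sq_eq {z : ℂ} {r : ℝ} (hr : 0 ≤ r) (h : z ^ 2 = (r : ℂ)) : z.im = 0 := by
  have h1 := congrArg Complex.re h
  have h2 := congrArg Complex.im h
  simp only [pow_two, Complex.mul_re, Complex.mul_im, Complex.ofReal_re, Complex.ofReal_im] at h1 h2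
  by_contra hne
  have h3 : z.re = 0 := by
    have : z.re * z.im = 0 := by linarith
    exact (mul_eq_zero.1 this).resolve_right hne
  rw [h3] at h1
  have := mul_self_pos.2 hne
  linarith

theorem re_eq_zero_of_sq_eq {z : ℂ} {r : ℝ} (hr : r ≤ 0) (h : z ^ 2 = (r : ℂ)) : z.re = 0 := by
  have := im_eq_zero_of_sq_eq (z := z * Complex.I) (r := -r) (by linarith)
    (by rw [mul_pow, h, Complex.I_sq]; push_cast; ring)
  simpa using this

theorem basisDensity_im_of_arc {a : ℕ} (ha : a ≤ P.n - 2) {i : Fin P.n} {θ : ℝ}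
    (hθ : θ ∈ Ioo (P.lo i) (P.hi i)) : (circlePt θ * P.basisDensity a (circlePt θ)).im = 0 := by
  obtain ⟨s, hs, h⟩ := P.exists_basisDensity_sq ha θ
  refine im_eq_zero_of_sq_eq ?_ h
  have := inv_lt_zero.2 (P.prod_arcSign_neg hθ)
  nlinarith

theorem basisDensity_re_of_adiabatic {a : ℕ} (ha : a ≤ P.n - 2) {ζ : ℂ}
    (hζ : ζ ∈ P.adiabatic) : (ζ * P.basisDensity a ζ).re = 0 := by
  obtain ⟨θ, rfl⟩ := exists_circlePt_eq (by simpa using hζ.1 : ‖ζ‖ = 1)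
  obtain ⟨s, hs, h⟩ := P.exists_basisDensity_sq ha θ
  refine re_eq_zero_of_sq_eq ?_ h
  have : 0 < ∏ i, P.arcSign i θ := Finset.prod_pos fun i _ => P.adiabatic_arcSign_pos hζ i
  have := inv_pos.2 this
  nlinarith [mul_nonneg hs this.le]

theorem differentiableOn_basisDensity (a : ℕ) :
    DifferentiableOn ℂ (P.basisDensity a) (slitDomain P.endpoint) := by
  refine DifferentiableOn.mul ?_ (differentiableOn_rootProduct _)
  unfold basisPoly
  fun_prop

theorem exists_norm_basisDensity_le (a : ℕ) :
    ∃ B : ℝ, 0 ≤ B ∧ ∀ z ∈ Metric.closedBall (0 : ℂ) 1,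
      ‖P.basisDensity a z‖ ≤ B * ∑ p, ‖z - P.endpoint p‖ ^ (-(1 / 2) : ℝ) := by
  obtain ⟨i, -⟩ := P.exists_hot
  have : Nonempty (Fin P.n × Bool) := ⟨(i, true)⟩
  obtain ⟨B, hB, hroot⟩ := exists_norm_rootProduct_le P.norm_endpoint P.injective_endpoint
  have hc : Continuous fun z => P.phase * P.basisPoly a z := by
    unfold basisPoly
    fun_prop
  obtain ⟨A, hA⟩ := (isCompact_closedBall (0 : ℂ) 1).exists_bound_of_continuousOn hc.continuousOn
  have hA0 : 0 ≤ A := (norm_nonneg _).trans (hA 0 (by simp))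
  refine ⟨A * B, mul_nonneg hA0 hB, fun z hz => ?_⟩
  rw [basisDensity, norm_mul, mul_assoc]
  exact mul_le_mul (hA z hz) (hroot z) (norm_nonneg _) hA0

theorem continuousOn_radialIntegral_basisDensity (a : ℕ) :
    ContinuousOn (radialIntegral (P.basisDensity a)) (Metric.closedBall 0 1) := by
  obtain ⟨B, hB, h⟩ := P.exists_norm_basisDensity_le a
  refine continuousOn_radialIntegral (B := B * Fintype.card (Fin P.n × Bool))
    ((P.differentiableOn_basisDensity a).continuousOn.mono
      (ball_subset_slitDomain P.norm_endpoint)) fun z hz t ht => ?_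
  have hz1 : ‖z‖ ≤ 1 := mem_closedBall_zero_iff.1 hz
  have htz : ‖(t : ℂ) * z‖ ≤ t := by
    rw [norm_mul, Complex.norm_real, Real.norm_of_nonneg ht.1]
    exact mul_le_of_le_one_right ht.1 hz1
  refine (h _ (mem_closedBall_zero_iff.2 (htz.trans ht.2.le))).trans ?_
  rw [mul_assoc]
  refine mul_le_mul_of_nonneg_left ?_ hB
  rw [← nsmul_eq_mul, ← Finset.card_univ]
  refine Finset.sum_le_card_nsmul _ _ _ fun p _ => ?_
  refine Real.rpow_le_rpow_of_nonpos (by linarith [ht.2]) ?_ (by norm_num)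
  -- A point of modulus at most `t` is at distance at least `1 - t` from every endpoint.
  have := norm_sub_norm_le (P.endpoint p) ((t : ℂ) * z)
  rw [P.norm_endpoint, norm_sub_rev] at this
  linarith

theorem hasDerivAt_radialIntegral_basisDensity (a : ℕ) {z : ℂ} (hz : z ∈ slitDomain P.endpoint) :
    HasDerivAt (radialIntegral (P.basisDensity a)) (P.basisDensity a z) z :=
  hasDerivAt_radialIntegral (isOpen_slitDomain _) (starConvex_slitDomain _)
    (P.differentiableOn_basisDensity a) hz

end Arrangement

end ShapeFactor

/-! ### Solving the interior problem by a dimension count. -/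

namespace ShapeFactor

open MeasureTheory InnerProductSpace

theorem HasDerivAt.re_comp_line {F : ℂ → ℂ} {d z : ℂ} (h : HasDerivAt F d z) (v : ℂ) :
    HasDerivAt (fun t : ℝ => (F (z + t * v)).re) (d * v).re 0 := by
  have h1 : HasDerivAt (fun t : ℝ => z + (t : ℂ) * v) v 0 := by
    simpa using ((Complex.ofRealCLM.hasDerivAt (x := (0 : ℝ))).mul_const v).const_add z
  have h2 : HasDerivAt (fun t : ℝ => F (z + (t : ℂ) * v)) (d * v) 0 :=
    HasDerivAt.comp (𝕜' := ℂ) (0 : ℝ) (by simpa using h) h1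
  exact (Complex.reCLM.hasFDerivAt.comp_hasDerivAt (0 : ℝ) h2)

namespace Arrangement

variable (P : Arrangement)

/-- The one-sided principle applies to both `u` and `-u`. -/
theorem eq_zero_of_mixed_boundary {u : ℂ → ℝ} {C : ℝ}
    (hc : ContinuousOn u (Metric.closedBall 0 1 \ {0})) (hh : HarmonicOnNhd u puncturedDisc)
    (hb : ∀ z ∈ puncturedDisc, |u z| ≤ C) (h0 : ∀ ζ ∈ P.hot ∪ P.cold, u ζ = 0)
    (hN : ∀ ζ ∈ P.adiabatic, HasNormalDeriv .interior u ζ 0)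
    {z : ℂ} (hz : z ∈ Metric.closedBall (0 : ℂ) 1 \ {0}) : u z = 0 := by
  have hcase : ∀ ζ : ℂ, ‖ζ‖ = 1 → ζ ∈ P.hot ∪ P.cold ∨ ζ ∈ P.adiabatic := by
    intro ζ hζ
    by_cases h : ζ ∈ P.hot ∪ P.cold
    · exact Or.inl h
    · exact Or.inr ⟨by simpa using hζ, h⟩
  obtain ⟨i, hi⟩ := P.exists_hot
  have hmem : circlePt (P.lo i) ∈ P.hot ∪ P.cold :=
    P.mem_isothermal_iff.2 ⟨i, _, left_mem_Icc.2 (P.lo_lt_hi i).le, rfl⟩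
  refine le_antisymm ?_ ?_
  · exact nonpos_of_mixed_boundary hc hh (fun z hz => (le_abs_self _).trans (hb z hz))
      (fun ζ hζ => (hcase ζ hζ).imp (fun h => (h0 ζ h).le) (hN ζ))
      ⟨_, norm_circlePt _, (h0 _ hmem).le⟩ hz
  · have hneg := nonpos_of_mixed_boundary (u := fun z => -u z) (C := C) hc.neg hh.neg
      (fun z hz => (neg_le_abs _).trans (hb z hz))
      (fun ζ hζ => (hcase ζ hζ).imp (fun h => by simp [h0 ζ h])
        (fun h => by simpa [HasNormalDeriv] using HasDerivWithinAt.fun_neg (hN ζ h)))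
      ⟨_, norm_circlePt (P.lo i), by simp [h0 _ hmem]⟩ hz
    simpa using hneg

/-- Real combinations of the `basisDensity` functions. -/
noncomputable def density (x : Fin (P.n - 1) → ℝ) (z : ℂ) : ℂ :=
  ∑ a, (x a : ℂ) * P.basisDensity a z

/-- Primitives of `density`. -/
noncomputable def potential (x : Fin (P.n - 1) → ℝ) (z : ℂ) : ℂ :=
  ∑ a, (x a : ℂ) * radialIntegral (P.basisDensity a) z

theorem index_le (a : Fin (P.n - 1)) : (a : ℕ) ≤ P.n - 2 := by
  have := a.2
  omega

theorem hasDerivAt_potential (x : Fin (P.n - 1) → ℝ) {z : ℂ} (hz : z ∈ slitDomain P.endpoint) :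
    HasDerivAt (P.potential x) (P.density x z) z :=
  HasDerivAt.fun_sum fun a _ => (P.hasDerivAt_radialIntegral_basisDensity a hz).const_mul _

theorem continuousOn_potential (x : Fin (P.n - 1) → ℝ) :
    ContinuousOn (P.potential x) (Metric.closedBall 0 1) :=
  continuousOn_finsetSum _ fun a _ =>
    continuousOn_const.mul (P.continuousOn_radialIntegral_basisDensity a)

theorem analyticAt_potential (x : Fin (P.n - 1) → ℝ) {z : ℂ} (hz : z ∈ slitDomain P.endpoint) :
    AnalyticAt ℂ (P.potential x) z :=
  DifferentiableOn.analyticAt (s := slitDomain P.endpoint)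
    (fun _ hw => (P.hasDerivAt_potential x hw).differentiableAt.differentiableWithinAt)
    ((isOpen_slitDomain _).mem_nhds hz)

theorem density_im_of_arc (x : Fin (P.n - 1) → ℝ) {i : Fin P.n} {θ : ℝ}
    (hθ : θ ∈ Ioo (P.lo i) (P.hi i)) : (circlePt θ * P.density x (circlePt θ)).im = 0 := by
  rw [density, Finset.mul_sum, Complex.im_sum]
  refine Finset.sum_eq_zero fun a _ => ?_
  rw [mul_left_comm, Complex.im_ofReal_mul, P.basisDensity_im_of_arc (P.index_le a) hθ, mul_zero]

theorem density_re_of_adiabatic (x : Fin (P.n - 1) → ℝ) {ζ : ℂ} (hζ : ζ ∈ P.adiabatic) :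
    (ζ * P.density x ζ).re = 0 := by
  rw [density, Finset.mul_sum, Complex.re_sum]
  refine Finset.sum_eq_zero fun a _ => ?_
  rw [mul_left_comm, Complex.re_ofReal_mul, P.basisDensity_re_of_adiabatic (P.index_le a) hζ,
    mul_zero]

theorem arc_mem_slitDomain {i : Fin P.n} {θ : ℝ} (hθ : θ ∈ Ioo (P.lo i) (P.hi i)) :
    circlePt θ ∈ slitDomain P.endpoint :=
  mem_slitDomain P.norm_endpoint (norm_circlePt θ).le (P.arc_ne_endpoint hθ)

theorem adiabatic_mem_slitDomain {ζ : ℂ} (hζ : ζ ∈ P.adiabatic) : ζ ∈ slitDomain P.endpoint :=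
  mem_slitDomain P.norm_endpoint (by simpa using hζ.1.le) (P.adiabatic_ne_endpoint hζ)

/-- The tangential derivative is minus the imaginary part of `ζ * density`, which vanishes inside
the arc. Continuity up to the circle includes the endpoints, where the density is singular. -/
theorem potential_re_arc (x : Fin (P.n - 1) → ℝ) {i : Fin P.n} {θ : ℝ}
    (hθ : θ ∈ Icc (P.lo i) (P.hi i)) :
    (P.potential x (circlePt θ)).re = (P.potential x (circlePt (P.lo i))).re := by
  rcases hθ.1.eq_or_lt with h | hlt
  · rw [h]
  have hcont : ContinuousOn (fun φ => (P.potential x (circlePt φ)).re) (Icc (P.lo i) θ) := by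
    refine Complex.continuous_re.comp_continuousOn
      ((P.continuousOn_potential x).comp continuous_circlePt.continuousOn fun φ _ => ?_)
    simp [norm_circlePt]
  have hderiv : ∀ φ ∈ Ioo (P.lo i) θ,
      HasDerivAt (fun φ => (P.potential x (circlePt φ)).re) 0 φ := by
    intro φ hφ
    have hφ' : φ ∈ Ioo (P.lo i) (P.hi i) := ⟨hφ.1, hφ.2.trans_le hθ.2⟩
    have h1 : HasDerivAt (fun φ => P.potential x (circlePt φ))
        (P.density x (circlePt φ) * (circlePt φ * Complex.I)) φ :=
      HasDerivAt.comp (𝕜' := ℂ) φ (P.hasDerivAt_potential x (P.arc_mem_slitDomain hφ'))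
        (hasDerivAt_circlePt φ)
    have h2 := Complex.reCLM.hasFDerivAt.comp_hasDerivAt φ h1
    refine h2.congr_deriv ?_
    have h3 := P.density_im_of_arc x hφ'
    rw [Complex.reCLM_apply, ← mul_assoc, mul_comm (P.density x _), Complex.mul_I_re, h3, neg_zero]
  obtain ⟨c, hc, hslope⟩ := exists_hasDerivAt_eq_slope _ (fun _ => 0) hlt hcont hderiv
  rw [eq_comm, div_eq_zero_iff] at hslope
  have := sub_pos.2 hlt
  rcases hslope with h | h <;> linarith

theorem intervalIntegrable_density (x : Fin (P.n - 1) → ℝ) (i : Fin P.n) :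
    IntervalIntegrable (fun θ => (circlePt θ * P.density x (circlePt θ)).re) volume
      (P.lo i) (P.hi i) := by
  choose B hB hle using P.exists_norm_basisDensity_le
  have hbound : IntervalIntegrable (fun θ => ∑ a : Fin (P.n - 1), |x a| *
      (B a * ∑ p, ‖circlePt θ - P.endpoint p‖ ^ (-(1 / 2) : ℝ))) volume (P.lo i) (P.hi i) := by
    have hinner : IntervalIntegrable
        (fun θ => ∑ p, ‖circlePt θ - P.endpoint p‖ ^ (-(1 / 2) : ℝ)) volume (P.lo i) (P.hi i) := by
      simpa only [Finset.sum_fn] using IntervalIntegrable.sum _ fun p _ =>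
        intervalIntegrable_norm_circlePt_sub_rpow (if p.2 then P.hi p.1 else P.lo p.1) _ _
    simpa only [Finset.sum_fn] using IntervalIntegrable.sum Finset.univ fun a _ =>
      (hinner.const_mul (B (a : Fin (P.n - 1)))).const_mul |x a|
  refine hbound.mono_fun ?_ ?_
  · rw [uIoc_of_le (P.lo_lt_hi i).le, ← Measure.restrict_congr_set Ioo_ae_eq_Ioc]
    refine ContinuousOn.aestronglyMeasurable ?_ measurableSet_Ioo
    refine Complex.continuous_re.comp_continuousOn (continuous_circlePt.continuousOn.mul ?_)
    refine continuousOn_finsetSum _ fun a _ => continuousOn_const.mul ?_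
    exact (P.differentiableOn_basisDensity a).continuousOn.comp continuous_circlePt.continuousOn
      fun θ hθ => P.arc_mem_slitDomain hθ
  · refine Eventually.of_forall fun θ => ?_
    beta_reduce
    refine (Complex.abs_re_le_norm _).trans ?_
    rw [norm_mul, norm_circlePt, one_mul, density]
    refine (norm_sum_le _ _).trans ((Finset.sum_le_sum fun a _ => ?_).trans (Real.le_norm_self _))
    rw [norm_mul, Complex.norm_real, Real.norm_eq_abs]
    exact mul_le_mul_of_nonneg_left (hle a _ (by simp [norm_circlePt])) (abs_nonneg _)

/-- The candidate temperature fields. -/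
noncomputable def field (x : Fin (P.n - 1) → ℝ) (c : ℝ) (z : ℂ) : ℝ := (P.potential x z).re + c

theorem continuousOn_field (x : Fin (P.n - 1) → ℝ) (c : ℝ) :
    ContinuousOn (P.field x c) (Metric.closedBall 0 1) :=
  (Complex.continuous_re.comp_continuousOn (P.continuousOn_potential x)).add continuousOn_const

theorem harmonicOnNhd_field (x : Fin (P.n - 1) → ℝ) (c : ℝ) :
    HarmonicOnNhd (P.field x c) (Metric.ball 0 1) := fun _ hz =>
  ((P.analyticAt_potential x (ball_subset_slitDomain P.norm_endpoint hz)).harmonicAt_re).add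
    (harmonicAt_const c)

theorem hasNormalDeriv_field (x : Fin (P.n - 1) → ℝ) (c : ℝ) {ζ : ℂ}
    (hζ : ζ ∈ slitDomain P.endpoint) :
    HasNormalDeriv .interior (P.field x c) ζ (ζ * P.density x ζ).re := by
  have := (HasDerivAt.re_comp_line (P.hasDerivAt_potential x hζ) ζ).add_const c
  rw [mul_comm] at this
  exact this.hasDerivWithinAt

/-- The derivative of `Re F` in the direction `conj (F' z)` is `|F' z| ^ 2`. -/
theorem density_eq_zero_of_field_eq_zero {x : Fin (P.n - 1) → ℝ} {c : ℝ}
    (h : ∀ z ∈ puncturedDisc, P.field x c z = 0) {z : ℂ} (hz : z ∈ puncturedDisc) :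
    P.density x z = 0 := by
  have hd := HasDerivAt.re_comp_line (P.hasDerivAt_potential x
    (ball_subset_slitDomain P.norm_endpoint hz.1)) ((starRingEnd ℂ) (P.density x z))
  have hev : ∀ᶠ t : ℝ in 𝓝 0,
      (P.potential x (z + t * (starRingEnd ℂ) (P.density x z))).re = -c := by
    have hcont : ContinuousAt (fun t : ℝ => z + t * (starRingEnd ℂ) (P.density x z)) 0 := by
      fun_prop
    have hnhds := hcont.eventually_mem (by simpa using isOpen_puncturedDisc.mem_nhds hz)
    filter_upwards [hnhds] with t ht
    have := h _ ht
    rw [field] at this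
    linarith
  have h0 := hd.unique ((hasDerivAt_const (0 : ℝ) (-c)).congr_of_eventuallyEq hev)
  rw [Complex.mul_conj, Complex.ofReal_re] at h0
  exact Complex.normSq_eq_zero.1 h0

/-- Up to factors that do not vanish on `(0, 1)`, the density is the polynomial with coefficients
`x` evaluated at the Möbius image `-I (z - 1) / (z + 1)`. Injectivity of that map yields infinitely
many roots. -/
theorem eq_zero_of_density_eq_zero {x : Fin (P.n - 1) → ℝ}
    (h : ∀ z ∈ puncturedDisc, P.density x z = 0) : x = 0 := by
  set q : Polynomial ℂ := ∑ a : Fin (P.n - 1), Polynomial.monomial (a : ℕ) (x a : ℂ) with hq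
  have hroot : ∀ t ∈ Ioo (0 : ℝ) 1, q.IsRoot (-(Complex.I * ((t : ℂ) - 1)) / (t + 1)) := by
    intro t ht
    have hmem : (t : ℂ) ∈ puncturedDisc := by
      refine ⟨?_, ?_⟩
      · rw [mem_ball_zero_iff, Complex.norm_real, Real.norm_of_nonneg ht.1.le]
        exact ht.2
      · simpa using ht.1.ne'
    have h1 : (t : ℂ) + 1 ≠ 0 := by
      have : ((t + 1 : ℝ) : ℂ) ≠ 0 := Complex.ofReal_ne_zero.2 (by linarith [ht.1])
      simpa using this
    have h0 := h _ hmem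
    have hφ := mul_ne_zero P.phase_ne_zero
      (rootProduct_ne_zero (ball_subset_slitDomain P.norm_endpoint hmem.1))
    have hfac : P.density x t = P.phase * rootProduct P.endpoint t * ((t + 1) ^ (P.n - 2)
        * q.eval (-(Complex.I * ((t : ℂ) - 1)) / (t + 1))) := by
      rw [density, hq, Polynomial.eval_finsetSum, Finset.mul_sum, Finset.mul_sum]
      refine Finset.sum_congr rfl fun a _ => ?_
      obtain ⟨b, hb⟩ := Nat.exists_eq_add_of_le (P.index_le a)
      rw [basisDensity, basisPoly, Polynomial.eval_monomial, hb, Nat.add_sub_cancel_left, div_pow,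
        pow_add]
      field_simp
    rw [hfac] at h0
    exact ((mul_eq_zero.1 ((mul_eq_zero.1 h0).resolve_left hφ)).resolve_left (pow_ne_zero _ h1))
  have hq0 : q = 0 := by
    refine Polynomial.eq_zero_of_infinite_isRoot q (Set.Infinite.mono ?_
      ((Ioo_infinite (zero_lt_one' ℝ)).image
        (f := fun t : ℝ => -(Complex.I * ((t : ℂ) - 1)) / (t + 1)) ?_))
    · rintro _ ⟨t, ht, rfl⟩
      exact hroot t ht
    · intro s hs t ht hst
      have h1 : ∀ r ∈ Ioo (0 : ℝ) 1, (r : ℂ) + 1 ≠ 0 := by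
        intro r hr
        have : ((r + 1 : ℝ) : ℂ) ≠ 0 := Complex.ofReal_ne_zero.2 (by linarith [hr.1])
        simpa using this
      beta_reduce at hst
      rw [div_eq_div_iff (h1 s hs) (h1 t ht)] at hst
      have h2 : (-(2 * Complex.I)) * (s : ℂ) = (-(2 * Complex.I)) * (t : ℂ) := by
        linear_combination hst
      have h3 := mul_left_cancel₀ (neg_ne_zero.2 (mul_ne_zero two_ne_zero Complex.I_ne_zero)) h2
      exact_mod_cast h3
  funext a
  have hcoeff : q.coeff a = x a := by
    rw [hq, Polynomial.finsetSum_coeff, Finset.sum_eq_single a]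
    · simp
    · intro b _ hb
      rw [Polynomial.coeff_monomial, if_neg (fun h => hb (Fin.ext h))]
    · simp
  rw [hq0, Polynomial.coeff_zero] at hcoeff
  exact_mod_cast hcoeff.symm

/-- The temperatures of `field` on the isothermal arcs. -/
noncomputable def arcTemperatures : ((Fin (P.n - 1) → ℝ) × ℝ) →ₗ[ℝ] (Fin P.n → ℝ) where
  toFun y i := P.field y.1 y.2 (circlePt (P.lo i))
  map_add' y y' := by
    funext i
    simp only [field, potential, Prod.fst_add, Prod.snd_add, Pi.add_apply, Complex.ofReal_add,
      add_mul, Finset.sum_add_distrib, Complex.add_re]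
    ring
  map_smul' r y := by
    funext i
    simp only [field, potential, Prod.smul_fst, Prod.smul_snd, Pi.smul_apply, smul_eq_mul,
      Complex.ofReal_mul, mul_assoc, ← Finset.mul_sum, Complex.re_ofReal_mul, RingHom.id_apply]
    ring

theorem field_arc (x : Fin (P.n - 1) → ℝ) (c : ℝ) {i : Fin P.n} {θ : ℝ}
    (hθ : θ ∈ Icc (P.lo i) (P.hi i)) : P.field x c (circlePt θ) = P.arcTemperatures (x, c) i := by
  simp only [arcTemperatures, LinearMap.coe_mk, AddHom.coe_mk, field, P.potential_re_arc x hθ]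

theorem neumann_field (x : Fin (P.n - 1) → ℝ) (c : ℝ) {ζ : ℂ} (hζ : ζ ∈ P.adiabatic) :
    HasNormalDeriv .interior (P.field x c) ζ 0 := by
  have := P.hasNormalDeriv_field x c (P.adiabatic_mem_slitDomain hζ)
  rwa [P.density_re_of_adiabatic x hζ] at this

theorem injective_arcTemperatures : Function.Injective P.arcTemperatures := by
  rw [← LinearMap.ker_eq_bot, LinearMap.ker_eq_bot']
  rintro ⟨x, c⟩ h
  obtain ⟨C, hC⟩ := (isCompact_closedBall (0 : ℂ) 1).exists_bound_of_continuousOn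
    (P.continuousOn_field x c)
  have hzero : ∀ z ∈ Metric.closedBall (0 : ℂ) 1 \ {0}, P.field x c z = 0 := by
    intro z hz
    refine P.eq_zero_of_mixed_boundary (C := C) ((P.continuousOn_field x c).mono sdiff_subset)
      ((P.harmonicOnNhd_field x c).mono sdiff_subset)
      (fun z hz => hC z (Metric.ball_subset_closedBall hz.1)) ?_
      (fun ζ hζ => P.neumann_field x c hζ) hz
    intro ζ hζ
    obtain ⟨i, θ, hθ, rfl⟩ := P.mem_isothermal_iff.1 hζ
    rw [P.field_arc x c hθ, h, Pi.zero_apply]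
  have hx : x = 0 := P.eq_zero_of_density_eq_zero fun z hz =>
    P.density_eq_zero_of_field_eq_zero
      (fun w hw => hzero w ⟨Metric.ball_subset_closedBall hw.1, hw.2⟩) hz
  -- Once `x = 0` the field is the constant `c`, so any one value determines it.
  have h1 := hzero 1 (by simp)
  rw [field, hx, potential] at h1
  simp only [Pi.zero_apply, Complex.ofReal_zero, zero_mul, Finset.sum_const_zero, Complex.zero_re,
    zero_add] at h1
  rw [hx, h1]
  rfl

/-- Uniqueness implies existence because both spaces have dimension `(n - 1) + 1 = n`. -/
theorem surjective_arcTemperatures : Function.Surjective P.arcTemperatures := by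
  refine (LinearMap.injective_iff_surjective_of_finrank_eq_finrank ?_).1 P.injective_arcTemperatures
  have := P.n_ge_two
  rw [Module.finrank_prod, Module.finrank_fin_fun, Module.finrank_fin_fun, Module.finrank_self]
  omega

/-- Solvability of the interior mixed problem with prescribed temperatures on the arcs. -/
theorem exists_interior_field (τ : Fin P.n → ℝ) :
    ∃ (T : ℂ → ℝ) (g : ℝ → ℝ), ContinuousOn T (Metric.closedBall 0 1) ∧
      HarmonicOnNhd T (Metric.ball 0 1) ∧
      (∀ i, ∀ θ ∈ Icc (P.lo i) (P.hi i), T (circlePt θ) = τ i) ∧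
      (∀ ζ ∈ P.adiabatic, HasNormalDeriv .interior T ζ 0) ∧
      (∀ i, ∀ θ ∈ Ioo (P.lo i) (P.hi i), HasNormalDeriv .interior T (circlePt θ) (g θ)) ∧
      ∀ i, IntervalIntegrable g volume (P.lo i) (P.hi i) := by
  obtain ⟨⟨x, c⟩, hx⟩ := P.surjective_arcTemperatures τ
  exact ⟨P.field x c, fun θ => (circlePt θ * P.density x (circlePt θ)).re,
    P.continuousOn_field x c, P.harmonicOnNhd_field x c,
    fun i θ hθ => by rw [P.field_arc x c hθ, hx], fun ζ hζ => P.neumann_field x c hζ,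
    fun i θ hθ => P.hasNormalDeriv_field x c (P.arc_mem_slitDomain hθ),
    P.intervalIntegrable_density x⟩

end Arrangement

end ShapeFactor

/-! ### Inversion in the circle, uniqueness of solutions and the common shape factor. -/

namespace ShapeFactor

open MeasureTheory InnerProductSpace ComplexConjugate

theorem exists_analyticAt_re_eq_of_harmonicAt {T : ℂ → ℝ} {z : ℂ} (h : HarmonicAt T z) :
    ∃ f : ℂ → ℂ, AnalyticAt ℂ f z ∧ ∀ᶠ w in 𝓝 z, T w = (f w).re := by
  obtain ⟨r, hr, hball⟩ := Metric.eventually_nhds_iff_ball.1 h.eventually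
  obtain ⟨f, hf, hfu⟩ :=
    HarmonicOnNhd.exists_analyticOnNhd_ball_re_eq (z := z) (R := r) (f := T) hball
  refine ⟨f, hf z (Metric.mem_ball_self hr), ?_⟩
  filter_upwards [Metric.ball_mem_nhds z hr] with w hw
  exact (hfu hw).symm

/-- Locally `T` is the real part of an analytic function, and composition with `g` keeps that
function analytic. -/
theorem HarmonicAt.comp_analyticAt {T : ℂ → ℝ} {g : ℂ → ℂ} {z : ℂ} (hT : HarmonicAt T (g z))
    (hg : AnalyticAt ℂ g z) : HarmonicAt (fun w => T (g w)) z := by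
  obtain ⟨f, hf, hTf⟩ := exists_analyticAt_re_eq_of_harmonicAt hT
  have hev : (fun w => T (g w)) =ᶠ[𝓝 z] fun w => ((f ∘ g) w).re := hg.continuousAt.eventually hTf
  exact (harmonicAt_congr_nhds hev).2 (hf.comp hg).harmonicAt_re

theorem HarmonicAt.comp_conj {T : ℂ → ℝ} {z : ℂ} (hT : HarmonicAt T (conj z)) :
    HarmonicAt (fun w => T (conj w)) z := by
  obtain ⟨f, hf, hTf⟩ := exists_analyticAt_re_eq_of_harmonicAt hT
  have hc : ContinuousAt (fun w : ℂ => conj w) z := Complex.continuous_conj.continuousAt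
  have ha : AnalyticAt ℂ (fun w => conj (f (conj w))) z := by
    rw [Complex.analyticAt_iff_eventually_differentiableAt] at hf ⊢
    filter_upwards [hc.eventually hf] with w hw
    exact differentiableAt_conj_conj_iff.2 hw
  refine (harmonicAt_congr_nhds ?_).2 ha.harmonicAt_re
  filter_upwards [hc.eventually hTf] with w hw
  rw [hw, Complex.conj_re]

/-- Inversion in the unit circle. -/
noncomputable def circleInv (z : ℂ) : ℂ := (conj z)⁻¹

theorem norm_circleInv (z : ℂ) : ‖circleInv z‖ = ‖z‖⁻¹ := by simp [circleInv]

theorem circleInv_circleInv (z : ℂ) : circleInv (circleInv z) = z := by simp [circleInv]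

theorem circleInv_smul {ζ : ℂ} (hζ : ‖ζ‖ = 1) (r : ℝ) :
    circleInv (r * ζ) = ((r⁻¹ : ℝ) : ℂ) * ζ := by
  have h : ζ * conj ζ = 1 := by
    rw [Complex.mul_conj, Complex.normSq_eq_norm_sq, hζ]; simp
  rw [circleInv, map_mul, Complex.conj_ofReal, mul_inv, Complex.ofReal_inv,
    inv_eq_of_mul_eq_one_left h]

theorem circleInv_of_norm_eq_one {ζ : ℂ} (hζ : ‖ζ‖ = 1) : circleInv ζ = ζ := by
  simpa using circleInv_smul hζ 1

theorem continuousAt_circleInv {z : ℂ} (hz : z ≠ 0) : ContinuousAt circleInv z :=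
  Complex.continuous_conj.continuousAt.inv₀ (by simpa using hz)

theorem HarmonicAt.comp_circleInv {T : ℂ → ℝ} {z : ℂ} (hz : z ≠ 0)
    (hT : HarmonicAt T (circleInv z)) : HarmonicAt (fun w => T (circleInv w)) z := by
  have h1 : HarmonicAt (fun w => T w⁻¹) (conj z) :=
    HarmonicAt.comp_analyticAt hT (analyticAt_inv (by simpa using hz))
  exact HarmonicAt.comp_conj h1

theorem closure_region_interior : closure (region .interior) = Metric.closedBall 0 1 :=
  closure_ball 0 one_ne_zero

theorem closure_region_exterior : closure (region .exterior) = {z | 1 ≤ ‖z‖} := by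
  have h1 : region .exterior = (Metric.closedBall (0 : ℂ) 1)ᶜ := by
    ext z; simp [region]
  rw [h1, closure_compl, interior_closedBall _ one_ne_zero]
  ext z; simp

theorem exterior_ne_zero {z : ℂ} (hz : 1 ≤ ‖z‖) : z ≠ 0 :=
  norm_pos_iff.1 (zero_lt_one.trans_le hz)

theorem add_outwardNormal_interior (ζ : ℂ) (t : ℝ) :
    ζ + t * outwardNormal .interior ζ = ((1 + t : ℝ) : ℂ) * ζ := by
  simp only [outwardNormal]; push_cast; ring

theorem add_outwardNormal_exterior (ζ : ℂ) (t : ℝ) :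
    ζ + t * outwardNormal .exterior ζ = ((1 - t : ℝ) : ℂ) * ζ := by
  simp only [outwardNormal]; push_cast; ring

theorem eventually_normal_mem_closure_region (s : Side) {ζ : ℂ} (hζ : ‖ζ‖ = 1) :
    ∀ᶠ t : ℝ in 𝓝[Iic 0] 0, ζ + t * outwardNormal s ζ ∈ closure (region s) := by
  have hev : ∀ᶠ t : ℝ in 𝓝[Iic 0] 0, -1 < t := nhdsWithin_le_nhds (Ioi_mem_nhds (by norm_num))
  filter_upwards [hev, self_mem_nhdsWithin] with t ht ht0
  have ht0 : t ≤ 0 := ht0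
  cases s
  · rw [closure_region_interior, add_outwardNormal_interior, mem_closedBall_zero_iff, norm_mul, hζ,
      Complex.norm_real, Real.norm_of_nonneg (by linarith)]
    linarith
  · rw [closure_region_exterior, add_outwardNormal_exterior, mem_ofPred_eq, norm_mul, hζ,
      Complex.norm_real, Real.norm_of_nonneg (by linarith)]
    linarith

theorem sphere_subset_closure_region (s : Side) {ζ : ℂ} (hζ : ‖ζ‖ = 1) :
    ζ ∈ closure (region s) := by
  cases s
  · rw [closure_region_interior]; simp [hζ]
  · rw [closure_region_exterior]; simp [hζ]

theorem HasNormalDeriv.congr {s : Side} {T T' : ℂ → ℝ} {ζ : ℂ} {d : ℝ}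
    (h : HasNormalDeriv s T ζ d) (hζ : ‖ζ‖ = 1)
    (hT : ∀ z ∈ closure (region s), T' z = T z) : HasNormalDeriv s T' ζ d := by
  refine HasDerivWithinAt.congr_of_eventuallyEq h ?_ ?_
  · filter_upwards [eventually_normal_mem_closure_region s hζ] with t ht
    exact hT _ ht
  · simpa using hT ζ (sphere_subset_closure_region s hζ)

theorem HasNormalDeriv.unique {s : Side} {T : ℂ → ℝ} {ζ : ℂ} {d d' : ℝ}
    (h : HasNormalDeriv s T ζ d) (h' : HasNormalDeriv s T ζ d') : d = d' :=
  (uniqueDiffOn_Iic (0 : ℝ) 0 self_mem_Iic).eq_deriv _ h h'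

/-- Along a ray inversion is `r ↦ 1 / r`, with derivative `-1` at `r = 1`. The two outward normals
are opposite, so the signs cancel. -/
theorem HasNormalDeriv.exterior_comp_circleInv {T : ℂ → ℝ} {ζ : ℂ} {d : ℝ} (hζ : ‖ζ‖ = 1)
    (h : HasNormalDeriv .interior T ζ d) :
    HasNormalDeriv .exterior (fun z => T (circleInv z)) ζ d := by
  have hφ : HasDerivWithinAt (fun t : ℝ => (1 - t)⁻¹ - 1) 1 (Iic 0) 0 := by
    have := (((hasDerivAt_id (0 : ℝ)).const_sub 1).fun_inv (by simp)).sub_const 1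
    simpa using this.hasDerivWithinAt (s := Iic 0)
  have hmaps : MapsTo (fun t : ℝ => (1 - t)⁻¹ - 1) (Iic 0) (Iic 0) := by
    intro t ht
    have ht : t ≤ 0 := ht
    have : (1 - t)⁻¹ ≤ 1 := inv_le_one_of_one_le₀ (by linarith)
    simpa using this
  have hcomp := HasDerivWithinAt.comp (h₂ := fun t : ℝ => T (ζ + t * outwardNormal .interior ζ))
    (0 : ℝ) (by simpa [HasNormalDeriv] using h) hφ hmaps
  rw [mul_one] at hcomp
  refine hcomp.congr (fun t _ => ?_) ?_ <;>
  · simp only [Function.comp_apply]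
    rw [add_outwardNormal_exterior, add_outwardNormal_interior, circleInv_smul hζ]
    congr 3
    ring

theorem HasNormalDeriv.interior_comp_circleInv {T : ℂ → ℝ} {ζ : ℂ} {d : ℝ} (hζ : ‖ζ‖ = 1)
    (h : HasNormalDeriv .exterior T ζ d) :
    HasNormalDeriv .interior (fun z => T (circleInv z)) ζ d := by
  -- The parameter stays above `-1`: the inner ray reaches the centre at `t = -1`, and beyond it the
  -- substitution leaves `Iic 0`.
  have hφ : HasDerivWithinAt (fun t : ℝ => 1 - (1 + t)⁻¹) 1 (Ioc (-1) 0) 0 := by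
    have := (((hasDerivAt_id (0 : ℝ)).const_add 1).fun_inv (by simp)).const_sub 1
    simpa using this.hasDerivWithinAt (s := Ioc (-1) 0)
  have hmaps : MapsTo (fun t : ℝ => 1 - (1 + t)⁻¹) (Ioc (-1) 0) (Iic 0) := by
    intro t ht
    have : 1 ≤ (1 + t)⁻¹ := (one_le_inv₀ (by linarith [ht.1])).2 (by linarith [ht.2])
    simpa using this
  have hcomp := HasDerivWithinAt.comp (h₂ := fun t : ℝ => T (ζ + t * outwardNormal .exterior ζ))
    (0 : ℝ) (by simpa [HasNormalDeriv] using h) hφ hmaps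
  rw [mul_one] at hcomp
  have hmem : Ioc (-1 : ℝ) 0 ∈ 𝓝[Iic 0] 0 := by
    rw [← Ioi_inter_Iic]
    exact inter_mem (nhdsWithin_le_nhds (Ioi_mem_nhds (by norm_num))) self_mem_nhdsWithin
  refine (hcomp.mono_of_mem_nhdsWithin hmem).congr (fun t _ => ?_) ?_ <;>
  · simp only [Function.comp_apply]
    rw [add_outwardNormal_exterior, add_outwardNormal_interior, circleInv_smul hζ]
    congr 3
    ring

theorem norm_of_mem_adiabatic {P : Arrangement} {ζ : ℂ} (h : ζ ∈ P.adiabatic) : ‖ζ‖ = 1 := by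
  simpa using h.1

theorem norm_of_mem_isothermal {P : Arrangement} {ζ : ℂ} (h : ζ ∈ P.hot ∪ P.cold) : ‖ζ‖ = 1 := by
  obtain ⟨i, θ, -, rfl⟩ := P.mem_isothermal_iff.1 h
  exact norm_circlePt θ

theorem circleInv_mem_exterior {z : ℂ} (hz : z ∈ puncturedDisc) :
    circleInv z ∈ region .exterior := by
  change 1 < ‖circleInv z‖
  rw [norm_circleInv]
  exact (one_lt_inv₀ (norm_pos_iff.2 hz.2)).2 (mem_ball_zero_iff.1 hz.1)

/-- Steady temperature fields are determined by the temperatures of the segments. -/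
theorem IsTemperature.eqOn {s : Side} {P : Arrangement} {Tc Th : ℝ} {T T' : ℂ → ℝ}
    (h : IsTemperature s P Tc Th T) (h' : IsTemperature s P Tc Th T') {z : ℂ}
    (hz : z ∈ closure (region s)) : T z = T' z := by
  obtain ⟨C, hC⟩ := h.bounded
  obtain ⟨C', hC'⟩ := h'.bounded
  have hb : ∀ z ∈ region s, |T z - T' z| ≤ C + C' := fun z hz =>
    (abs_sub _ _).trans (add_le_add (hC z hz) (hC' z hz))
  have h0 : ∀ ζ ∈ P.hot ∪ P.cold, T ζ - T' ζ = 0 := by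
    rintro ζ (hζ | hζ)
    · rw [h.eq_hot ζ hζ, h'.eq_hot ζ hζ, sub_self]
    · rw [h.eq_cold ζ hζ, h'.eq_cold ζ hζ, sub_self]
  have hN : ∀ ζ ∈ P.adiabatic, HasNormalDeriv s (fun z => T z - T' z) ζ 0 := fun ζ hζ => by
    simpa [HasNormalDeriv] using HasDerivWithinAt.fun_sub (h.neumann ζ hζ) (h'.neumann ζ hζ)
  have hh : HarmonicOnNhd (fun z => T z - T' z) (region s) := h.harmonic.sub h'.harmonic
  have hc : ContinuousOn (fun z => T z - T' z) (closure (region s)) :=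
    h.continuousOn.sub h'.continuousOn
  rw [← sub_eq_zero]
  cases s
  · have hp : ∀ w ∈ Metric.closedBall (0 : ℂ) 1 \ {0}, T w - T' w = 0 := fun w hw => by
      rw [closure_region_interior] at hc
      exact P.eq_zero_of_mixed_boundary (hc.mono sdiff_subset) (hh.mono sdiff_subset)
        (fun w hw => hb w hw.1) h0 hN hw
    -- The centre was removed only to share the argument with the exterior; it is recovered by
    -- continuity.
    rcases eq_or_ne z 0 with rfl | hz0
    · have hcont : ContinuousAt (fun z => T z - T' z) 0 :=
        (hh 0 (Metric.mem_ball_self one_pos)).1.continuousAt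
      have hlim : Tendsto (fun z => T z - T' z) (𝓝[≠] (0 : ℂ)) (𝓝 0) := by
        refine tendsto_const_nhds.congr' ?_
        filter_upwards [self_mem_nhdsWithin,
          nhdsWithin_le_nhds (Metric.closedBall_mem_nhds (0 : ℂ) one_pos)] with w hw0 hw1
        exact (hp w ⟨hw1, hw0⟩).symm
      exact tendsto_nhds_unique (hcont.tendsto.mono_left nhdsWithin_le_nhds) hlim
    · rw [closure_region_interior] at hz
      exact hp z ⟨hz, hz0⟩
  · rw [closure_region_exterior] at hz hc
    have hz1 : 1 ≤ ‖z‖ := hz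
    have hinv : circleInv z ∈ Metric.closedBall (0 : ℂ) 1 \ {0} := by
      refine ⟨?_, ?_⟩
      · rw [mem_closedBall_zero_iff, norm_circleInv]
        exact inv_le_one_of_one_le₀ hz1
      · simpa [circleInv] using exterior_ne_zero hz1
    have := P.eq_zero_of_mixed_boundary (u := fun w => T (circleInv w) - T' (circleInv w))
      (C := C + C') ?_ ?_ ?_ ?_ ?_ hinv
    · simpa [circleInv_circleInv] using this
    · refine hc.comp (fun w hw => (continuousAt_circleInv hw.2).continuousWithinAt) fun w hw => ?_
      rw [mem_ofPred_eq, norm_circleInv]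
      exact (one_le_inv₀ (norm_pos_iff.2 hw.2)).2 (mem_closedBall_zero_iff.1 hw.1)
    · exact fun w hw => HarmonicAt.comp_circleInv (T := fun z => T z - T' z) hw.2
        (hh _ (circleInv_mem_exterior hw))
    · exact fun w hw => hb _ (circleInv_mem_exterior hw)
    · intro ζ hζ
      rw [circleInv_of_norm_eq_one (norm_of_mem_isothermal hζ), h0 ζ hζ]
    · exact fun ζ hζ => (hN ζ hζ).interior_comp_circleInv (norm_of_mem_adiabatic hζ)

/-- Inversion in the circle takes interior solutions to exterior ones. -/
theorem IsTemperature.comp_circleInv {P : Arrangement} {Tc Th : ℝ} {T : ℂ → ℝ}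
    (h : IsTemperature .interior P Tc Th T) :
    IsTemperature .exterior P Tc Th fun z => T (circleInv z) where
  harmonic z hz := by
    have hz : 1 < ‖z‖ := hz
    refine HarmonicAt.comp_circleInv (exterior_ne_zero hz.le) (h.harmonic _ ?_)
    rw [region, mem_ball_zero_iff, norm_circleInv]
    exact inv_lt_one_of_one_lt₀ hz
  continuousOn := by
    rw [closure_region_exterior]
    refine h.continuousOn.comp
      (fun z hz => (continuousAt_circleInv (exterior_ne_zero hz)).continuousWithinAt) fun z hz => ?_
    rw [closure_region_interior, mem_closedBall_zero_iff, norm_circleInv]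
    exact inv_le_one_of_one_le₀ hz
  bounded := by
    obtain ⟨C, hC⟩ := h.bounded
    refine ⟨C, fun z hz => hC _ ?_⟩
    have hz : 1 < ‖z‖ := hz
    rw [region, mem_ball_zero_iff, norm_circleInv]
    exact inv_lt_one_of_one_lt₀ hz
  eq_hot ζ hζ := by
    rw [circleInv_of_norm_eq_one (norm_of_mem_isothermal (Or.inl hζ)), h.eq_hot ζ hζ]
  eq_cold ζ hζ := by
    rw [circleInv_of_norm_eq_one (norm_of_mem_isothermal (Or.inr hζ)), h.eq_cold ζ hζ]
  neumann ζ hζ := (h.neumann ζ hζ).exterior_comp_circleInv (norm_of_mem_adiabatic hζ)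

theorem HasNormalDeriv.affine {s : Side} {T : ℂ → ℝ} {ζ : ℂ} {d : ℝ} (h : HasNormalDeriv s T ζ d)
    (a b : ℝ) : HasNormalDeriv s (fun z => b * T z + a) ζ (b * d) :=
  (HasDerivWithinAt.const_mul b h).add_const a

theorem IsTemperature.affine {s : Side} {P : Arrangement} {T : ℂ → ℝ}
    (h : IsTemperature s P 0 1 T) (Tc Th : ℝ) :
    IsTemperature s P Tc Th fun z => (Th - Tc) * T z + Tc where
  harmonic := (h.harmonic.const_smul (c := Th - Tc)).add (harmonicOnNhd_const Tc)
  continuousOn := (continuousOn_const.mul h.continuousOn).add continuousOn_const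
  bounded := by
    obtain ⟨C, hC⟩ := h.bounded
    refine ⟨|Th - Tc| * C + |Tc|, fun z hz => (abs_add_le _ _).trans ?_⟩
    rw [abs_mul]
    exact add_le_add_left (mul_le_mul_of_nonneg_left (hC z hz) (abs_nonneg _)) _
  eq_hot ζ hζ := by rw [h.eq_hot ζ hζ]; ring
  eq_cold ζ hζ := by rw [h.eq_cold ζ hζ]; ring
  neumann ζ hζ := by simpa using (h.neumann ζ hζ).affine Tc (Th - Tc)

namespace Arrangement

/-- The normalized interior problem has a solution with integrable flux density. -/
theorem exists_interior_temperature (P : Arrangement) :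
    ∃ (T : ℂ → ℝ) (g : ℝ → ℝ), IsTemperature .interior P 0 1 T ∧
      (∀ i, ∀ θ ∈ Ioo (P.lo i) (P.hi i), HasNormalDeriv .interior T (circlePt θ) (g θ)) ∧
      ∀ i, IntervalIntegrable g volume (P.lo i) (P.hi i) := by
  classical
  obtain ⟨T, g, hc, hh, hτ, hN, hg, hint⟩ := P.exists_interior_field fun i =>
    if P.isHot i then 1 else 0
  refine ⟨T, g, ⟨hh, closure_region_interior ▸ hc, ?_, ?_, ?_, hN⟩, hg, hint⟩
  · obtain ⟨C, hC⟩ := (isCompact_closedBall (0 : ℂ) 1).exists_bound_of_continuousOn hc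
    exact ⟨C, fun z hz => hC z (Metric.ball_subset_closedBall hz)⟩
  · intro ζ hζ
    simp only [hot, mem_iUnion, mem_image, exists_prop] at hζ
    obtain ⟨i, hi, θ, hθ, rfl⟩ := hζ
    rw [hτ i θ hθ, if_pos hi]
  · intro ζ hζ
    simp only [cold, mem_iUnion, mem_image, exists_prop] at hζ
    obtain ⟨i, hi, θ, hθ, rfl⟩ := hζ
    rw [hτ i θ hθ, if_neg hi]

end Arrangement

/-- Normal derivatives are determined inside each hot arc, and the remaining endpoints are null. -/
theorem HasHeatFlow.unique {s : Side} {P : Arrangement} {k : ℝ} {T : ℂ → ℝ} {Q Q' : ℝ}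
    (h : HasHeatFlow s P k T Q) (h' : HasHeatFlow s P k T Q') : Q = Q' := by
  obtain ⟨g, hg, -, rfl⟩ := h
  obtain ⟨g', hg', -, rfl⟩ := h'
  refine Finset.sum_congr rfl fun i hi => ?_
  have hi : P.isHot i := by simpa using hi
  refine intervalIntegral.integral_congr_ae ?_
  have hne : ∀ᵐ θ : ℝ, θ ≠ P.hi i := by simp [ae_iff, measure_singleton]
  filter_upwards [hne] with θ hθ hmem
  rw [uIoc_of_le (P.lo_lt_hi i).le] at hmem
  have hmem' : θ ∈ Ioo (P.lo i) (P.hi i) := ⟨hmem.1, lt_of_le_of_ne hmem.2 hθ⟩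
  rw [(hg i hi θ hmem').unique (hg' i hi θ hmem')]

/-- A normalized solution with integrable flux density determines the shape factor. -/
theorem isShapeFactor_of_temperature {s : Side} {P : Arrangement} {T : ℂ → ℝ} {g : ℝ → ℝ}
    (hT : IsTemperature s P 0 1 T)
    (hg : ∀ i, ∀ θ ∈ Ioo (P.lo i) (P.hi i), HasNormalDeriv s T (circlePt θ) (g θ))
    (hint : ∀ i, IntervalIntegrable g volume (P.lo i) (P.hi i)) :
    IsShapeFactor s P (open Classical in ∑ i with P.isHot i, ∫ θ in P.lo i..P.hi i, g θ) := by
  intro k Tc Th _ _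
  refine ⟨⟨_, hT.affine Tc Th⟩, fun T' hT' => ⟨fun θ => (Th - Tc) * g θ, ?_, ?_, ?_⟩⟩
  -- By uniqueness every solution is the affine image of the normalized one on the closed domain,
  -- which contains the normal segments near the circle.
  · intro i _ θ hθ
    exact ((hg i θ hθ).affine Tc (Th - Tc)).congr (norm_circlePt θ) fun z hz =>
      hT'.eqOn (hT.affine Tc Th) hz
  · exact fun i _ => (hint i).const_mul _
  · rw [Finset.sum_mul, Finset.sum_mul]
    refine Finset.sum_congr rfl fun i _ => ?_
    rw [intervalIntegral.integral_const_mul, intervalIntegral.integral_const_mul]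
    ring

theorem IsShapeFactor.unique {s : Side} {P : Arrangement} {S S' : ℝ} (h : IsShapeFactor s P S)
    (h' : IsShapeFactor s P S') : S = S' := by
  obtain ⟨⟨T, hT⟩, hflow⟩ := h 1 0 1 one_pos one_pos
  have := (hflow T hT).unique ((h' 1 0 1 one_pos one_pos).2 T hT)
  simpa using this

/-- The interior and the exterior problem have a common shape factor. -/
theorem exists_isShapeFactor (P : Arrangement) : ∃ S, ∀ s, IsShapeFactor s P S := by
  obtain ⟨T, g, hT, hg, hint⟩ := P.exists_interior_temperature
  refine ⟨open Classical in ∑ i with P.isHot i, ∫ θ in P.lo i..P.hi i, g θ, fun s => ?_⟩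
  cases s
  · exact isShapeFactor_of_temperature hT hg hint
  · exact isShapeFactor_of_temperature hT.comp_circleInv
      (fun i θ hθ => (hg i θ hθ).exterior_comp_circleInv (norm_circlePt θ)) hint

/-! ### Reflection in the real axis. -/

section Reflection

variable {P : Arrangement}

theorem conj_mem_image_circlePt {ζ : ℂ} {a b : ℝ} :
    ζ ∈ circlePt '' Icc (-b) (-a) ↔ conj ζ ∈ circlePt '' Icc a b := by
  constructor
  · rintro ⟨θ, hθ, rfl⟩
    exact ⟨-θ, ⟨by linarith [hθ.2], by linarith [hθ.1]⟩, (conj_circlePt θ).symm⟩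
  · rintro ⟨θ, hθ, h⟩
    refine ⟨-θ, ⟨by linarith [hθ.2], by linarith [hθ.1]⟩, ?_⟩
    rw [← conj_circlePt, h, Complex.conj_conj]

theorem mem_reflect_hot {ζ : ℂ} : ζ ∈ P.reflect.hot ↔ conj ζ ∈ P.hot := by
  simp only [Arrangement.hot, mem_iUnion, exists_prop]
  refine Fin.revPerm.exists_congr fun i => and_congr Iff.rfl conj_mem_image_circlePt

theorem mem_reflect_cold {ζ : ℂ} : ζ ∈ P.reflect.cold ↔ conj ζ ∈ P.cold := by
  simp only [Arrangement.cold, mem_iUnion, exists_prop]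
  refine Fin.revPerm.exists_congr fun i => and_congr Iff.rfl conj_mem_image_circlePt

theorem mem_reflect_adiabatic {ζ : ℂ} : ζ ∈ P.reflect.adiabatic ↔ conj ζ ∈ P.adiabatic := by
  simp [Arrangement.adiabatic, mem_reflect_hot, mem_reflect_cold]

theorem conj_mem_region {s : Side} {z : ℂ} (hz : z ∈ region s) : conj z ∈ region s := by
  cases s <;> simpa [region] using hz

theorem conj_mem_closure_region {s : Side} {z : ℂ} (hz : z ∈ closure (region s)) :
    conj z ∈ closure (region s) := by
  cases s
  · rw [closure_region_interior] at hz ⊢; simpa using hz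
  · rw [closure_region_exterior] at hz ⊢; simpa using hz

theorem HasNormalDeriv.comp_conj {s : Side} {T : ℂ → ℝ} {ζ : ℂ} {d : ℝ}
    (h : HasNormalDeriv s T (conj ζ) d) : HasNormalDeriv s (fun z => T (conj z)) ζ d := by
  unfold HasNormalDeriv at h ⊢
  convert h using 4 with t
  cases s <;> simp [outwardNormal]

theorem IsTemperature.comp_conj {s : Side} {Tc Th : ℝ} {T : ℂ → ℝ}
    (h : IsTemperature s P Tc Th T) : IsTemperature s P.reflect Tc Th fun z => T (conj z) where
  harmonic z hz := HarmonicAt.comp_conj (h.harmonic _ (conj_mem_region hz))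
  continuousOn := h.continuousOn.comp Complex.continuous_conj.continuousOn
    fun _ hz => conj_mem_closure_region hz
  bounded := by
    obtain ⟨C, hC⟩ := h.bounded
    exact ⟨C, fun z hz => hC _ (conj_mem_region hz)⟩
  eq_hot ζ hζ := h.eq_hot _ (mem_reflect_hot.1 hζ)
  eq_cold ζ hζ := h.eq_cold _ (mem_reflect_cold.1 hζ)
  neumann ζ hζ := (h.neumann _ (mem_reflect_adiabatic.1 hζ)).comp_conj

theorem HasHeatFlow.comp_conj {s : Side} {k : ℝ} {T : ℂ → ℝ} {Q : ℝ}
    (h : HasHeatFlow s P k T Q) : HasHeatFlow s P.reflect k (fun z => T (conj z)) Q := by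
  obtain ⟨g, hg, hint, rfl⟩ := h
  refine ⟨fun θ => g (-θ), fun i hi θ hθ => ?_, fun i hi => ?_, ?_⟩
  · refine HasNormalDeriv.comp_conj ?_
    rw [conj_circlePt]
    have h1 : -P.hi i.rev < θ := hθ.1
    have h2 : θ < -P.lo i.rev := hθ.2
    exact hg i.rev hi (-θ) ⟨by linarith, by linarith⟩
  · have := (hint i.rev hi).comp_sub_left 0
    simp only [zero_sub] at this
    exact this.symm
  · classical
    rw [Finset.sum_filter, Finset.sum_filter, ← Equiv.sum_comp Fin.revPerm]
    refine Finset.sum_congr rfl fun i _ => ?_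
    have : ∫ θ in P.reflect.lo i..P.reflect.hi i, k * g (-θ)
        = ∫ θ in P.lo i.rev..P.hi i.rev, k * g θ := by
      rw [intervalIntegral.integral_comp_neg fun θ => k * g θ]
      simp [Arrangement.reflect]
    rw [this]
    rfl

/-- The mirrored arrangement already has some shape factor, so comparing the flow of one mirrored
solution identifies it; there is no need to mirror every solution back. -/
theorem isShapeFactor_reflect {s : Side} {S : ℝ} (h : IsShapeFactor s P S) :
    IsShapeFactor s P.reflect S := by
  obtain ⟨S', hS'⟩ := exists_isShapeFactor P.reflect
  obtain ⟨⟨T, hT⟩, hflow⟩ := h 1 0 1 one_pos one_pos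
  have := (hflow T hT).comp_conj.unique ((hS' s 1 0 1 one_pos one_pos).2 _ hT.comp_conj)
  have hSS : S = S' := by simpa using this
  exact hSS ▸ hS' s

end Reflection

end ShapeFactor

/-! ### The two maps of the Riemann sphere. -/

namespace ShapeFactor

open ComplexConjugate

section Sphere

theorem sphereInv_infty : sphereInv OnePoint.infty = ((0 : ℂ) : OnePoint ℂ) := rfl

theorem sphereInv_zero : sphereInv ((0 : ℂ) : OnePoint ℂ) = OnePoint.infty := if_pos rfl

theorem sphereInv_coe {z : ℂ} (hz : z ≠ 0) :
    sphereInv (z : OnePoint ℂ) = ((z⁻¹ : ℂ) : OnePoint ℂ) :=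
  if_neg hz

theorem sphereInv_sphereInv (p : OnePoint ℂ) : sphereInv (sphereInv p) = p := by
  induction p using OnePoint.rec with
  | infty => rw [sphereInv_infty, sphereInv_zero]
  | coe z =>
    rcases eq_or_ne z 0 with rfl | hz
    · rw [sphereInv_zero, sphereInv_infty]
    · rw [sphereInv_coe hz, sphereInv_coe (inv_ne_zero hz), inv_inv]

theorem continuous_sphereInv : Continuous sphereInv := by
  have hcob : Bornology.cobounded ℂ = coclosedCompact ℂ := by
    rw [Metric.cobounded_eq_cocompact, coclosedCompact_eq_cocompact]
  refine continuous_iff_continuousAt.2 fun p => ?_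
  induction p using OnePoint.rec with
  | infty =>
    rw [OnePoint.continuousAt_infty', sphereInv_infty]
    have h : Tendsto (fun z : ℂ => ((z⁻¹ : ℂ) : OnePoint ℂ)) (coclosedCompact ℂ)
        (𝓝 ((0 : ℂ) : OnePoint ℂ)) := by
      rw [← hcob]
      exact (OnePoint.continuous_coe.tendsto 0).comp tendsto_inv₀_cobounded
    refine h.congr' ?_
    rw [← hcob]
    filter_upwards [Bornology.eventually_ne_cobounded (0 : ℂ)] with z hz
    exact (sphereInv_coe hz).symm
  | coe z =>
    rw [OnePoint.continuousAt_coe]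
    rcases eq_or_ne z 0 with rfl | hz
    · rw [continuousAt_iff_punctured_nhds]
      have h : Tendsto (fun z : ℂ => ((z⁻¹ : ℂ) : OnePoint ℂ)) (𝓝[≠] 0) (𝓝 OnePoint.infty) := by
        refine OnePoint.tendsto_coe_infty.comp ?_
        rw [← hcob]
        exact tendsto_inv₀_nhdsNE_zero
      simp only [Function.comp_apply, sphereInv_zero]
      refine h.congr' ?_
      filter_upwards [self_mem_nhdsWithin] with w hw
      exact (sphereInv_coe hw).symm
    · have h : ContinuousAt (fun z : ℂ => ((z⁻¹ : ℂ) : OnePoint ℂ)) z :=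
        OnePoint.continuous_coe.continuousAt.comp (continuousAt_inv₀ hz)
      refine h.congr ?_
      filter_upwards [eventually_ne_nhds hz] with w hw
      exact (sphereInv_coe hw).symm

theorem sphereConj_infty : sphereConj OnePoint.infty = OnePoint.infty := rfl

theorem sphereConj_coe (z : ℂ) : sphereConj (z : OnePoint ℂ) = ((conj z : ℂ) : OnePoint ℂ) := rfl

theorem sphereConj_sphereConj (p : OnePoint ℂ) : sphereConj (sphereConj p) = p := by
  induction p using OnePoint.rec with
  | infty => rfl
  | coe z => rw [sphereConj_coe, sphereConj_coe, Complex.conj_conj]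

theorem continuous_sphereConj : Continuous sphereConj := by
  refine continuous_iff_continuousAt.2 fun p => ?_
  induction p using OnePoint.rec with
  | infty =>
    rw [OnePoint.continuousAt_infty', sphereConj_infty]
    refine OnePoint.tendsto_coe_infty.comp (g := ((↑) : ℂ → OnePoint ℂ)) ?_
    rw [coclosedCompact_eq_cocompact]
    exact Complex.conjCLE.toHomeomorph.isClosedEmbedding.tendsto_cocompact
  | coe z =>
    rw [OnePoint.continuousAt_coe]
    exact OnePoint.continuous_coe.continuousAt.comp Complex.continuous_conj.continuousAt

/-- This is why inversion requires the mirrored arrangement: on the circle it acts just as complex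
conjugation does. -/
theorem sphereInv_coe_circle {ζ : ℂ} (hζ : ‖ζ‖ = 1) :
    sphereInv (ζ : OnePoint ℂ) = ((conj ζ : ℂ) : OnePoint ℂ) := by
  rw [sphereInv_coe (norm_ne_zero_iff.1 (by rw [hζ]; exact one_ne_zero)), Complex.inv_eq_conj hζ]

/-- A map that acts on the circle as conjugation takes conjugate sets to each other. -/
theorem image_onSphere_eq {f : OnePoint ℂ → OnePoint ℂ}
    (hf : ∀ ζ : ℂ, ‖ζ‖ = 1 → f ζ = ((conj ζ : ℂ) : OnePoint ℂ)) {A B : Set ℂ}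
    (hA : ∀ ζ ∈ A, ‖ζ‖ = 1) (hB : ∀ ζ, ζ ∈ B ↔ conj ζ ∈ A) : f '' onSphere A = onSphere B := by
  ext p
  simp only [onSphere, mem_image, exists_exists_and_eq_and]
  constructor
  · rintro ⟨ζ, hζ, rfl⟩
    exact ⟨conj ζ, by rwa [hB, Complex.conj_conj], (hf ζ (hA ζ hζ)).symm⟩
  · rintro ⟨ζ, hζ, rfl⟩
    refine ⟨conj ζ, (hB ζ).1 hζ, ?_⟩
    rw [hf _ (hA _ ((hB ζ).1 hζ)), Complex.conj_conj]

/-- Both sphere maps are continuous involutions that conjugate the circle. Being involutive reduces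
bijectivity to two inclusions, and the boundary matching sees only conjugation. -/
theorem carries_of_conj_on_circle {f : OnePoint ℂ → OnePoint ℂ} (hinv : Function.Involutive f)
    (hcont : Continuous f) (hf : ∀ ζ : ℂ, ‖ζ‖ = 1 → f ζ = ((conj ζ : ℂ) : OnePoint ℂ))
    {s s' : Side} {P P' : Arrangement} (h1 : MapsTo f (sphereRegion s) (sphereRegion s'))
    (h2 : MapsTo f (sphereRegion s') (sphereRegion s))
    (hhot : ∀ ζ, ζ ∈ P'.hot ↔ conj ζ ∈ P.hot) (hcold : ∀ ζ, ζ ∈ P'.cold ↔ conj ζ ∈ P.cold)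
    (had : ∀ ζ, ζ ∈ P'.adiabatic ↔ conj ζ ∈ P.adiabatic) : Carries f s P s' P' where
  bijOn_region := InvOn.bijOn ⟨fun p _ => hinv p, fun p _ => hinv p⟩ h1 h2
  bijOn_boundary := by
    have h := (hinv.injective.injOn (s := onSphere (Metric.sphere 0 1))).bijOn_image
    rwa [image_onSphere_eq hf (B := Metric.sphere 0 1) (fun ζ hζ => by simpa using hζ)
      (fun ζ => by simp)] at h
  continuousOn := hcont.continuousOn
  image_hot := image_onSphere_eq hf (fun _ hζ => norm_of_mem_isothermal (Or.inl hζ)) hhot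
  image_cold := image_onSphere_eq hf (fun _ hζ => norm_of_mem_isothermal (Or.inr hζ)) hcold
  image_adiabatic := image_onSphere_eq hf (fun _ hζ => norm_of_mem_adiabatic hζ) had

theorem mapsTo_sphereInv_interior :
    MapsTo sphereInv (sphereRegion .interior) (sphereRegion .exterior) := by
  rintro _ ⟨z, hz, rfl⟩
  have hz : ‖z‖ < 1 := mem_ball_zero_iff.1 hz
  rcases eq_or_ne z 0 with rfl | hz0
  · exact Or.inl sphereInv_zero
  · refine Or.inr ⟨z⁻¹, ?_, (sphereInv_coe hz0).symm⟩
    change 1 < ‖z⁻¹‖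
    rw [norm_inv]
    exact (one_lt_inv₀ (norm_pos_iff.2 hz0)).2 hz

theorem mapsTo_sphereInv_exterior :
    MapsTo sphereInv (sphereRegion .exterior) (sphereRegion .interior) := by
  rintro _ (rfl | ⟨z, hz, rfl⟩)
  · exact ⟨0, Metric.mem_ball_self one_pos, sphereInv_infty.symm⟩
  · have hz : 1 < ‖z‖ := hz
    refine ⟨z⁻¹, ?_, (sphereInv_coe (exterior_ne_zero hz.le)).symm⟩
    rw [region, mem_ball_zero_iff, norm_inv]
    exact inv_lt_one_of_one_lt₀ hz

theorem mapsTo_sphereConj_exterior :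
    MapsTo sphereConj (sphereRegion .exterior) (sphereRegion .exterior) := by
  rintro _ (rfl | ⟨z, hz, rfl⟩)
  · exact Or.inl sphereConj_infty
  · exact Or.inr ⟨conj z, conj_mem_region hz, (sphereConj_coe z).symm⟩

theorem sphereHolomorphicAt_sphereInv_coe (a : ℂ) :
    SphereHolomorphicAt sphereInv (a : OnePoint ℂ) := by
  refine ⟨continuous_sphereInv.continuousAt, ?_⟩
  rcases eq_or_ne a 0 with rfl | ha
  -- The coordinate at `∞` is again `1 / z`, so at the pole the map reads as the identity; the value
  -- at `w = 0` agrees since the coordinate of `∞` is set to `0`.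
  · have h : (fun w => sphereCoord (sphereInv ((0 : ℂ) : OnePoint ℂ))
        (sphereInv (sphereParam ((0 : ℂ) : OnePoint ℂ) w))) = fun w => w := by
      funext w
      have hp : sphereParam ((0 : ℂ) : OnePoint ℂ) w = (w : OnePoint ℂ) := by
        change ((0 + w : ℂ) : OnePoint ℂ) = _
        rw [zero_add]
      rw [hp, sphereInv_zero]
      rcases eq_or_ne w 0 with rfl | hw
      · rw [sphereInv_zero]; rfl
      · rw [sphereInv_coe hw]
        exact inv_inv w
    rw [h]
    exact analyticAt_id
  · have h : (fun w : ℂ => (a + w)⁻¹ - a⁻¹) =ᶠ[𝓝 0] fun w =>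
        sphereCoord (sphereInv (a : OnePoint ℂ)) (sphereInv (sphereParam (a : OnePoint ℂ) w)) := by
      have hne : ∀ᶠ w : ℂ in 𝓝 0, a + w ≠ 0 :=
        (continuous_const.add continuous_id).continuousAt.eventually_ne (by simpa using ha)
      filter_upwards [hne] with w hw
      have hp : sphereParam (a : OnePoint ℂ) w = ((a + w : ℂ) : OnePoint ℂ) := rfl
      rw [hp, sphereInv_coe ha, sphereInv_coe hw]
      rfl
    refine AnalyticAt.congr ?_ h
    exact ((analyticAt_const.add analyticAt_id).inv (by simpa using ha)).sub analyticAt_const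

end Sphere

theorem conformallyEquivalentVia_sphereInv (P : Arrangement) :
    ConformallyEquivalentVia sphereInv .interior P .exterior P.reflect where
  toCarries := carries_of_conj_on_circle sphereInv_sphereInv continuous_sphereInv
    (fun _ hζ => sphereInv_coe_circle hζ) mapsTo_sphereInv_interior mapsTo_sphereInv_exterior
    (fun _ => mem_reflect_hot) (fun _ => mem_reflect_cold) (fun _ => mem_reflect_adiabatic)
  holomorphic := by
    rintro _ ⟨z, -, rfl⟩
    exact sphereHolomorphicAt_sphereInv_coe z

theorem carries_sphereConj (P : Arrangement) :
    Carries sphereConj .exterior P.reflect .exterior P :=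
  carries_of_conj_on_circle sphereConj_sphereConj continuous_sphereConj
    (fun ζ _ => sphereConj_coe ζ) mapsTo_sphereConj_exterior mapsTo_sphereConj_exterior
    (fun _ => by rw [mem_reflect_hot, Complex.conj_conj])
    (fun _ => by rw [mem_reflect_cold, Complex.conj_conj])
    (fun _ => by rw [mem_reflect_adiabatic, Complex.conj_conj])

end ShapeFactor

theorem mainTheorem3 (P : ShapeFactor.Arrangement) :
    -- `z ↦ 1 / z` is a conformal equivalence of the interior problem with the reflected
    -- exterior problem, and reflection takes that back to the exterior problem itself
    ShapeFactor.ConformallyEquivalentVia ShapeFactor.sphereInv .interior P .exterior P.reflect ∧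
    ShapeFactor.Carries ShapeFactor.sphereConj .exterior P.reflect .exterior P ∧
    -- the shape factors exist, are unique, and agree
    ∃ S : ℝ, ∀ S' : ℝ,
      (ShapeFactor.IsShapeFactor .interior P S' ↔ S' = S) ∧
      (ShapeFactor.IsShapeFactor .exterior P S' ↔ S' = S) ∧
      (ShapeFactor.IsShapeFactor .exterior P.reflect S' ↔ S' = S) := by
  obtain ⟨S, hS⟩ := ShapeFactor.exists_isShapeFactor P
  have hiff : ∀ {s : ShapeFactor.Side} {P' : ShapeFactor.Arrangement}
      (_ : ShapeFactor.IsShapeFactor s P' S) (S' : ℝ),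
      ShapeFactor.IsShapeFactor s P' S' ↔ S' = S := fun h S' =>
    ⟨fun h' => h'.unique h, fun h' => h' ▸ h⟩
  exact ⟨ShapeFactor.conformallyEquivalentVia_sphereInv P, ShapeFactor.carries_sphereConj P, S,
    fun S' => ⟨hiff (hS .interior) S', hiff (hS .exterior) S',
      hiff (ShapeFactor.isShapeFactor_reflect (hS .exterior)) S'⟩⟩
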